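/- Let $k$ be a field with separable closure $k_s$, and let $A$ be an Azumaya algebra of degree $n\geq 1$ over $k$, i.e. $A\otimes_k k_s\cong M_n(k_s)$. For integers $1\le i_1<\dots<i_r\le n$ let $\mathrm{Flag}(i_1,\dots,i_r;A)$ be the $k$-scheme representing the functor that sends a commutative $k$-algebra $R$ to the set of chains $I_1\subset\dots\subset I_r$ of left ideals of $A\otimes_k R$ such that $(A\otimes_k R)/I_j$ is locally free of rank $n^2-ni_j$ over $R$ for all $j$; put $\mathrm{SB}(A)=\mathrm{Flag}(1;A)$. For a left ideal $J$ of $A\otimes_k R$ let $J^\circ=\{a : Ja=0\}$ be its right annihilator. For a vector bundle $\mathcal V$ of rank $m$ on a $k$-scheme (or functor) $S$ and integers $0\le d_1<\dots<d_s\le m$, let $\mathrm{Drapeau}(d_1,\dots,d_s;\mathcal V)\to S$ be the flag bundle whose $R$-points over $x\in S(R)$ are the chains $W_1\subset\dots\subset W_s$ of submodules of $x^*\mathcal V$ with $x^*\mathcal V/W_j$ locally free of rank $m-d_j$. Let $1=i_1<i_2<\dots<i_r\le n$. Let $\mathcal I\subset A\otimes_k\mathcal O_{\mathrm{SB}(A)}$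 be the tautological sheaf of left ideals, whose value at a point $I\in \mathrm{SB}(A)(R)$ is $I$. Then $\mathcal V=\mathcal I^\circ\mathcal I$, whose value at $I\in\mathrm{SB}(A)(R)$ is the $R$-module $I^\circ I\subset A\otimes_k R$, is a vector bundle of rank $n-1$ on $\mathrm{SB}(A)$, and there is a unique isomorphism over $\mathrm{SB}(A)$ $$\mathrm{Flag}(1,i_2,\dots,i_r;A)\;\xrightarrow{\ \sim\ }\;\mathrm{Drapeau}(n-i_r,\dots,n-i_2;\mathcal V)$$ that is given on $R$-points, for every commutative $k$-algebra $R$, by $$(I_1,\dots,I_r)\longmapsto (I_r^\circ I_1\subset I_{r-1}^\circ I_1\subset\dots\subset I_2^\circ I_1\subset I_1^\circ I_1).$$ This holds for the functors of points, and for any $k$-schemes that represent them. -/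

import Mathlib

open CategoryTheory AlgebraicGeometry TensorProduct

universe u

namespace TwistedFlag

noncomputable section

/-! ### Azumaya algebras, locally free modules, base change -/

/-- `A` is an Azumaya algebra of degree `n` over the field `k`: over a separable closure of `k` it
becomes isomorphic to the algebra of `n × n` matrices. -/
def IsAzumayaOfDegree (k : Type u) [Field k] (A : Type u) [Ring A] [Algebra k A] (n : ℕ) : Prop :=
  1 ≤ n ∧ Nonempty
    (SeparableClosure k ⊗[k] A ≃ₐ[SeparableClosure k] Matrix (Fin n) (Fin n) (SeparableClosure k))

/-- The `R`-module `M` is locally free of rank `d` (finitely generated projective, of rank `d` at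
every prime). -/
structure IsLocFree (R : Type u) [CommRing R] (M : Type u) [AddCommGroup M] [Module R M]
    (d : ℕ) : Prop where
  finite : Module.Finite R M
  projective : Module.Projective R M
  rank : ∀ p : PrimeSpectrum R, Module.rankAtStalk (R := R) M p = d

/-- A semilinear map `M → M'` over a ring map `φ : R → R'` exhibits `M'` as the base change
`R' ⊗[R] M`. -/
def IsBaseChangeAlong {R R' : Type u} [CommRing R] [CommRing R'] (φ : R →+* R') {M M' : Type u}
    [AddCommGroup M] [Module R M] [AddCommGroup M'] [Module R' M'] (θ : M →ₛₗ[φ] M') : Prop :=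
  letI : Algebra R R' := φ.toAlgebra
  letI : Module R M' := Module.compHom M' φ
  haveI : IsScalarTower R R' M' := ⟨fun r s m => mul_smul (φ r) s m⟩
  IsBaseChange R' ({ toFun := θ, map_add' := θ.map_add, map_smul' := θ.map_smulₛₗ } : M →ₗ[R] M')

theorem IsBaseChangeAlong.of_isBaseChange {R R' M M' : Type u} [CommRing R] [CommRing R']
    [alg : Algebra R R'] [AddCommGroup M] [Module R M] [AddCommGroup M'] [Module R' M']
    [mod : Module R M'] [tow : IsScalarTower R R' M'] {φ : R →+* R'} (hφ : algebraMap R R' = φ)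
    {θ : M →ₛₗ[φ] M'} {t : M →ₗ[R] M'} (ht : IsBaseChange R' t) (h : ∀ x, t x = θ x) :
    IsBaseChangeAlong φ θ := by
  subst hφ
  have e1 : (algebraMap R R').toAlgebra = alg := Algebra.algebra_ext _ _ fun _ => rfl
  have e2 : Module.compHom M' (algebraMap R R') = mod :=
    Module.ext' _ _ fun r m => algebraMap_smul R' r m
  have e3 : ⇑t = ⇑θ := funext h
  unfold IsBaseChangeAlong
  convert ht using 1
  congr!
  exact e3.symm

/-- The `R'`-submodule of `M'` generated by the image of an `R`-submodule of `M`. -/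
def extend {R R' : Type u} [CommRing R] [CommRing R'] {φ : R →+* R'} {M M' : Type u}
    [AddCommGroup M] [Module R M] [AddCommGroup M'] [Module R' M'] (θ : M →ₛₗ[φ] M')
    (W : Submodule R M) : Submodule R' M' :=
  Submodule.span R' (θ '' W)

theorem extend_mono {R R' : Type u} [CommRing R] [CommRing R'] {φ : R →+* R'} {M M' : Type u}
    [AddCommGroup M] [Module R M] [AddCommGroup M'] [Module R' M'] (θ : M →ₛₗ[φ] M')
    {W W' : Submodule R M} (h : W ≤ W') : extend θ W ≤ extend θ W' :=
  Submodule.span_mono (Set.image_mono h)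

theorem isLocFree_quotient_of_isBaseChange {R R' M M' : Type u} [CommRing R] [CommRing R']
    [Algebra R R'] [AddCommGroup M] [Module R M] [AddCommGroup M'] [Module R' M'] [Module R M']
    [IsScalarTower R R' M'] {t : M →ₗ[R] M'} (ht : IsBaseChange R' t) {W : Submodule R M} {d : ℕ}
    (hW : IsLocFree R (M ⧸ W) d) : IsLocFree R' (M' ⧸ Submodule.span R' (t '' W)) d := by
  let W' : Submodule R' M' := Submodule.span R' (t '' W)
  let q : (M ⧸ W) →ₗ[R] (M' ⧸ W') := W.liftQ ((W'.mkQ.restrictScalars R).comp t) (by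
    intro w hw
    have : t w ∈ W' := Submodule.subset_span ⟨w, hw, rfl⟩
    simpa using this)
  let g : M →ₗ[R] R' ⊗[R] (M ⧸ W) := (TensorProduct.mk R R' (M ⧸ W) 1).comp W.mkQ
  have hle : W' ≤ LinearMap.ker (ht.lift g) := by
    refine Submodule.span_le.2 ?_
    rintro _ ⟨w, hw, rfl⟩
    have h2 : W.mkQ w = 0 := by simpa using hw
    have h1 : ht.lift g (t w) = 0 := by rw [ht.lift_eq]; simp only [g, LinearMap.comp_apply, h2,
      map_zero]
    exact h1
  let e : R' ⊗[R] (M ⧸ W) ≃ₗ[R'] (M' ⧸ W') :=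
    LinearEquiv.ofLinearMap (q.liftBaseChange R') (W'.liftQ (ht.lift g) hle)
      (by
        apply Submodule.linearMap_qext
        apply ht.algHom_ext
        intro x
        change q.liftBaseChange R' (ht.lift g (t x)) = W'.mkQ (t x)
        rw [ht.lift_eq]
        simp [g, q])
      (by
        apply TensorProduct.AlgebraTensorModule.curry_injective
        ext x
        change W'.liftQ (ht.lift g) hle (q.liftBaseChange R' (1 ⊗ₜ W.mkQ x)) = 1 ⊗ₜ W.mkQ x
        have h3 : q.liftBaseChange R' ((1 : R') ⊗ₜ W.mkQ x) = W'.mkQ (t x) := by simp [q]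
        rw [h3]
        exact ht.lift_eq g x)
  have hq : IsBaseChange R' q := IsBaseChange.of_equiv e fun x => by simp [e]
  have := hW.finite
  have := hW.projective
  exact ⟨Module.Finite.equiv hq.equiv, Module.Projective.of_equiv hq.equiv,
    fun p => (Module.rankAtStalk_isBaseChange hq p).trans (hW.rank _)⟩

/-- A submodule with locally free quotient stays so after base change, with the same rank. -/
theorem IsBaseChangeAlong.isLocFree_quotient {R R' : Type u} [CommRing R] [CommRing R']
    {φ : R →+* R'} {M M' : Type u} [AddCommGroup M] [Module R M] [AddCommGroup M'] [Module R' M']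
    {θ : M →ₛₗ[φ] M'} (hθ : IsBaseChangeAlong φ θ) {W : Submodule R M} {d : ℕ}
    (hW : IsLocFree R (M ⧸ W) d) : IsLocFree R' (M' ⧸ extend θ W) d :=
  letI : Algebra R R' := φ.toAlgebra
  letI : Module R M' := Module.compHom M' φ
  haveI : IsScalarTower R R' M' := ⟨fun r s m => mul_smul (φ r) s m⟩
  isLocFree_quotient_of_isBaseChange (R := R) (R' := R') hθ hW

/-! ### Schemes and vector bundles through functors of points -/

/-- The functor of points `R ↦ X(R) = Hom_k(Spec R, X)` of a `k`-scheme `X`, on `k`-algebras. A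
`k`-scheme `X` represents a functor `F` on `k`-algebras if `(points k).obj X ≅ F`. -/
def points (k : Type u) [Field k] :
    Over (Spec (CommRingCat.of k)) ⥤ (CommAlgCat.{u} k ⥤ Type u) :=
  yoneda ⋙ (Functor.whiskeringLeft _ _ _).obj (algSpec (CommRingCat.of k)).rightOp

variable {k : Type u} [Field k]

/-- A family of modules on a functor `F` on `k`-algebras: an `R`-module for every point
`x ∈ F(R)`, with functorial semilinear maps for `R → R'`. -/
structure ModuleFamily (F : CommAlgCat.{u} k ⥤ Type u) where
  obj : F.Elements → Type u
  [addCommGroup : ∀ p, AddCommGroup (obj p)]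
  [module : ∀ p, Module p.1 (obj p)]
  res : ∀ {p q : F.Elements} (f : p ⟶ q), obj p →ₛₗ[(f.val.hom : p.1 →+* q.1)] obj q
  res_id : ∀ (p : F.Elements) (x : obj p), res (𝟙 p) x = x
  res_comp : ∀ {p q r : F.Elements} (f : p ⟶ q) (g : q ⟶ r) (x : obj p),
    res (f ≫ g) x = res g (res f x)

attribute [instance] ModuleFamily.addCommGroup ModuleFamily.module

namespace ModuleFamily

/-- The family is a vector bundle of rank `m`: its value at every point is locally free of
rank `m`, and it is compatible with base change. For `F = (points k).obj S` this is a locally free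
sheaf of rank `m` on the scheme `S`, given by its pull-backs along all `Spec R ⟶ S`. -/
structure IsVectorBundle {F : CommAlgCat.{u} k ⥤ Type u} (V : ModuleFamily F) (m : ℕ) : Prop where
  locFree : ∀ p, IsLocFree p.1 (V.obj p) m
  baseChange : ∀ {p q : F.Elements} (f : p ⟶ q), IsBaseChangeAlong _ (V.res f)

/-- The point `g(x) ∈ G(R)` for a point `x ∈ F(R)` and a morphism of functors `g`. -/
abbrev mapPoint {F G : CommAlgCat.{u} k ⥤ Type u} (g : F ⟶ G) (p : F.Elements) : G.Elements :=
  ⟨p.1, g.app p.1 p.2⟩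

/-- A map of points of `F` as a map of the image points of `G`. -/
abbrev mapPointHom {F G : CommAlgCat.{u} k ⥤ Type u} (g : F ⟶ G) {p q : F.Elements} (f : p ⟶ q) :
    mapPoint g p ⟶ mapPoint g q :=
  ⟨f.val, by
    have h := NatTrans.naturality_apply g f.val p.2
    rw [CategoryOfElements.map_snd] at h
    exact h.symm⟩

/-- The pull-back of a family of modules along a morphism of functors. -/
abbrev pullback {F G : CommAlgCat.{u} k ⥤ Type u} (V : ModuleFamily G) (g : F ⟶ G) :
    ModuleFamily F where
  obj p := V.obj (mapPoint g p)
  addCommGroup p := V.addCommGroup (mapPoint g p)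
  module p := V.module (mapPoint g p)
  res f := V.res (mapPointHom g f)
  res_id _ x := V.res_id _ x
  res_comp f f' x := V.res_comp (mapPointHom g f) (mapPointHom g f') x

theorem IsVectorBundle.pullback {F G : CommAlgCat.{u} k ⥤ Type u} {V : ModuleFamily G} {m : ℕ}
    (hV : V.IsVectorBundle m) (g : F ⟶ G) : (V.pullback g).IsVectorBundle m where
  locFree p := hV.locFree (mapPoint g p)
  baseChange f := hV.baseChange (mapPointHom g f)

theorem extend_res_id {F : CommAlgCat.{u} k ⥤ Type u} (V : ModuleFamily F) (p : F.Elements)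
    (W : Submodule p.1 (V.obj p)) : extend (V.res (𝟙 p)) W = W := by
  have h : (V.res (𝟙 p)) '' (W : Set (V.obj p)) = W := by
    have h' : ⇑(V.res (𝟙 p)) = id := funext (V.res_id p)
    rw [h', Set.image_id]
  exact (congrArg (Submodule.span p.1) h).trans (Submodule.span_eq W)

theorem extend_res_comp {F : CommAlgCat.{u} k ⥤ Type u} (V : ModuleFamily F) {p q r : F.Elements}
    (f : p ⟶ q) (g : q ⟶ r) (W : Submodule p.1 (V.obj p)) :
    extend (V.res (f ≫ g)) W = extend (V.res g) (extend (V.res f) W) := by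
  apply le_antisymm
  · refine Submodule.span_le.2 ?_
    rintro _ ⟨w, hw, rfl⟩
    rw [V.res_comp]
    exact Submodule.subset_span ⟨_, Submodule.subset_span ⟨w, hw, rfl⟩, rfl⟩
  · refine Submodule.span_le.2 ?_
    rintro _ ⟨y, hy, rfl⟩
    refine Submodule.span_induction (p := fun y _ => V.res g y ∈ extend (V.res (f ≫ g)) W)
      ?_ ?_ ?_ ?_ hy
    · rintro _ ⟨w, hw, rfl⟩
      rw [← V.res_comp]
      exact Submodule.subset_span ⟨w, hw, rfl⟩
    · rw [map_zero]; exact Submodule.zero_mem _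
    · intro a b _ _ ha hb
      rw [map_add]; exact Submodule.add_mem _ ha hb
    · intro c a _ ha
      rw [map_smulₛₗ]; exact Submodule.smul_mem _ _ ha

/-- Flags `W₁ ⊆ … ⊆ W_s` of submodules of the value of `V` at `p`, with locally free quotients of
ranks `m - d₁, …, m - d_s`. -/
def Flags {F : CommAlgCat.{u} k ⥤ Type u} (V : ModuleFamily F) (m : ℕ) {s : ℕ} (d : Fin s → ℕ)
    (p : F.Elements) : Type u :=
  {W : Fin s → Submodule p.1 (V.obj p) //
    Monotone W ∧ ∀ j, IsLocFree p.1 (V.obj p ⧸ W j) (m - d j)}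

/-- Flags in the pull-back of `V` at `p` are flags in `V` at the image of `p`. -/
def Flags.ofPullback {F G : CommAlgCat.{u} k ⥤ Type u} {V : ModuleFamily G} {g : F ⟶ G} {m s : ℕ}
    {d : Fin s → ℕ} {p : F.Elements} (W : (V.pullback g).Flags m d p) :
    V.Flags m d (mapPoint g p) :=
  W

/-- Base change of flags in a vector bundle. -/
def Flags.map {F : CommAlgCat.{u} k ⥤ Type u} {V : ModuleFamily F} {m : ℕ}
    (hV : V.IsVectorBundle m) {s : ℕ} {d : Fin s → ℕ} {p q : F.Elements} (f : p ⟶ q)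
    (W : V.Flags m d p) : V.Flags m d q :=
  ⟨fun j => extend (V.res f) (W.1 j), fun _ _ h => extend_mono _ (W.2.1 h),
    fun j => (hV.baseChange f).isLocFree_quotient (W.2.2 j)⟩

/-- The bundle of flag varieties `Drapeau(d₁, …, d_s; V)` of a vector bundle `V` of rank `m` on `F`:
an `R`-point is a point `x ∈ F(R)` with a flag of type `d` in the value of `V` at `x`. -/
def IsVectorBundle.flagBundle {F : CommAlgCat.{u} k ⥤ Type u} {V : ModuleFamily F} {m : ℕ}
    (hV : V.IsVectorBundle m) {s : ℕ} (d : Fin s → ℕ) : CommAlgCat.{u} k ⥤ Type u where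
  obj R := Σ x : F.obj R, V.Flags m d ⟨R, x⟩
  map {R R'} f := ↾fun y => ⟨F.map f y.1, Flags.map hV (q := ⟨R', F.map f y.1⟩) ⟨f, rfl⟩ y.2⟩
  map_id R := by
    refine ConcreteCategory.hom_ext _ _ fun ⟨x, W⟩ => ?_
    have key : ∀ (x' : F.obj R) (h : F.map (𝟙 R) x = x'), x' = x →
        (⟨x', Flags.map hV (p := ⟨R, x⟩) (q := ⟨R, x'⟩) ⟨𝟙 R, h⟩ W⟩ :
          Σ x : F.obj R, V.Flags m d ⟨R, x⟩) = ⟨x, W⟩ := by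
      rintro x' h rfl
      congr 1
      exact Subtype.ext (funext fun j => extend_res_id V _ _)
    exact key _ rfl (by simp)
  map_comp {R R' R''} f g := by
    refine ConcreteCategory.hom_ext _ _ fun ⟨x, W⟩ => ?_
    have key : ∀ (x'' : F.obj R'') (h : F.map (f ≫ g) x = x''), x'' = F.map g (F.map f x) →
        (⟨x'', Flags.map hV (p := ⟨R, x⟩) (q := ⟨R'', x''⟩) ⟨f ≫ g, h⟩ W⟩ :
          Σ x : F.obj R'', V.Flags m d ⟨R'', x⟩) =
        ⟨F.map g (F.map f x), Flags.map hV (p := ⟨R', F.map f x⟩)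
          (q := ⟨R'', F.map g (F.map f x)⟩) ⟨g, rfl⟩
          (Flags.map hV (p := ⟨R, x⟩) (q := ⟨R', F.map f x⟩) ⟨f, rfl⟩ W)⟩ := by
      rintro x'' h rfl
      congr 1
      exact Subtype.ext (funext fun j =>
        extend_res_comp V (p := ⟨R, x⟩) (q := ⟨R', F.map f x⟩)
          (r := ⟨R'', F.map g (F.map f x)⟩) ⟨f, rfl⟩ ⟨g, rfl⟩ _)
    exact key _ rfl (by simp)

/-- The structure morphism of the flag bundle. -/
def IsVectorBundle.flagBundleProj {F : CommAlgCat.{u} k ⥤ Type u} {V : ModuleFamily F} {m : ℕ}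
    (hV : V.IsVectorBundle m) {s : ℕ} (d : Fin s → ℕ) : hV.flagBundle d ⟶ F where
  app _ := ↾fun y => y.1
  naturality _ _ _ := rfl

end ModuleFamily

/-! ### Twisted flag varieties -/

variable (A : Type u) [Ring A] [Algebra k A]

/-- The ring map `R ⊗[k] A → R' ⊗[k] A` induced by a map of `k`-algebras `R → R'`. -/
def scalarExt {R R' : CommAlgCat.{u} k} (f : R ⟶ R') : (R ⊗[k] A) →ₐ[k] (R' ⊗[k] A) :=
  Algebra.TensorProduct.map f.hom (AlgHom.id k A)

/-- The map `scalarExt` as a semilinear map. -/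
def scalarExtₛₗ {R R' : CommAlgCat.{u} k} (f : R ⟶ R') :
    (R ⊗[k] A) →ₛₗ[(f.hom : R →+* R')] (R' ⊗[k] A) where
  toFun := scalarExt A f
  map_add' := map_add _
  map_smul' r x := by
    rw [Algebra.smul_def, map_mul, Algebra.smul_def]
    simp [scalarExt, Algebra.TensorProduct.algebraMap_apply]

theorem isBaseChangeAlong_scalarExtₛₗ {R R' : CommAlgCat.{u} k} (f : R ⟶ R') :
    IsBaseChangeAlong _ (scalarExtₛₗ A f) := by
  let : Algebra R R' := (f.hom : R →+* R').toAlgebra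
  have : IsScalarTower k R R' := IsScalarTower.of_algebraMap_eq fun x => (f.hom.commutes x).symm
  refine IsBaseChangeAlong.of_isBaseChange rfl
    (isBaseChange_tensorProduct_map (R := k) (S := R) (P := A) R' (IsBaseChange.linearMap R R'))
    fun x => ?_
  change _ = scalarExt A f x
  induction x with
  | zero => rw [map_zero, map_zero]
  | add x y hx hy => rw [map_add, map_add, hx, hy]
  | tmul r a => rfl

/-- The extension of a left ideal is generated by its image already as a module over the scalars. -/
theorem restrictScalars_map {R R' : CommAlgCat.{u} k} (f : R ⟶ R') (I : Ideal (R ⊗[k] A)) :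
    (I.map (scalarExt A f)).restrictScalars R' =
      extend (scalarExtₛₗ A f) (I.restrictScalars R) := by
  apply le_antisymm
  · intro x hx
    refine Submodule.span_induction
      (p := fun x _ => x ∈ extend (scalarExtₛₗ A f) (I.restrictScalars R)) ?_ ?_ ?_ ?_ hx
    · rintro _ ⟨y, hy, rfl⟩
      exact Submodule.subset_span ⟨y, hy, rfl⟩
    · exact Submodule.zero_mem _
    · intro a b _ _ ha hb
      exact Submodule.add_mem _ ha hb
    · intro c a _ ha
      refine Submodule.span_induction
        (p := fun a _ => c • a ∈ extend (scalarExtₛₗ A f) (I.restrictScalars R)) ?_ ?_ ?_ ?_ ha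
      · rintro _ ⟨y, hy, rfl⟩
        induction c with
        | zero => rw [zero_smul]; exact Submodule.zero_mem _
        | add c d hc hd => rw [add_smul]; exact Submodule.add_mem _ hc hd
        | tmul r b =>
          have h : (r ⊗ₜ[k] b : R' ⊗[k] A) • scalarExtₛₗ A f y =
              r • scalarExtₛₗ A f (((1 : R) ⊗ₜ[k] b) * y) := by
            change (r ⊗ₜ[k] b : R' ⊗[k] A) * scalarExt A f y =
              r • scalarExt A f (((1 : R) ⊗ₜ[k] b) * y)
            rw [map_mul, ← smul_mul_assoc]
            simp [scalarExt, TensorProduct.smul_tmul']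
          rw [h]
          exact Submodule.smul_mem _ _ (Submodule.subset_span ⟨_, I.mul_mem_left _ hy, rfl⟩)
      · rw [smul_zero]; exact Submodule.zero_mem _
      · intro a b _ _ ha hb
        rw [smul_add]; exact Submodule.add_mem _ ha hb
      · intro r a _ ha
        rw [smul_comm]; exact Submodule.smul_mem _ _ ha
  · refine Submodule.span_le.2 ?_
    rintro _ ⟨y, hy, rfl⟩
    exact Ideal.mem_map_of_mem (scalarExt A f) hy

theorem scalarExt_id (R : CommAlgCat.{u} k) : scalarExt A (𝟙 R) = AlgHom.id k (R ⊗[k] A) := by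
  ext <;> simp [scalarExt]

theorem scalarExt_comp {R R' R'' : CommAlgCat.{u} k} (f : R ⟶ R') (g : R' ⟶ R'') :
    scalarExt A (f ≫ g) = (scalarExt A g).comp (scalarExt A f) := by
  ext <;> simp [scalarExt]

theorem map_scalarExt_id {R : CommAlgCat.{u} k} (I : Ideal (R ⊗[k] A)) :
    I.map (scalarExt A (𝟙 R)) = I := by
  rw [scalarExt_id]
  exact Ideal.map_id I

theorem map_scalarExt_comp {R R' R'' : CommAlgCat.{u} k} (f : R ⟶ R') (g : R' ⟶ R'')
    (I : Ideal (R ⊗[k] A)) :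
    I.map (scalarExt A (f ≫ g)) = (I.map (scalarExt A f)).map (scalarExt A g) := by
  rw [scalarExt_comp]
  exact (Ideal.map_map (scalarExt A f).toRingHom (scalarExt A g).toRingHom).symm

/-- The points of `Flag(i₁, …, i_r; A)` in `R`: chains `I₁ ⊆ … ⊆ I_r` of left ideals of `A ⊗ R`
whose quotients are locally free of ranks `n² - n i_j`. -/
def FlagPoints (n : ℕ) {r : ℕ} (i : Fin r → ℕ) (R : CommAlgCat.{u} k) : Type u :=
  {I : Fin r → Ideal (R ⊗[k] A) // Monotone I ∧
    ∀ j, IsLocFree R ((R ⊗[k] A) ⧸ (I j).restrictScalars R) (n ^ 2 - n * i j)}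

/-- The twisted flag variety `Flag(i₁, …, i_r; A)` through its functor of points. -/
def flag (n : ℕ) {r : ℕ} (i : Fin r → ℕ) : CommAlgCat.{u} k ⥤ Type u where
  obj R := FlagPoints A n i R
  map f := ↾fun I => ⟨fun j => (I.1 j).map (scalarExt A f), fun _ _ h => Ideal.map_mono (I.2.1 h),
    fun j => by
      rw [restrictScalars_map]
      exact (isBaseChangeAlong_scalarExtₛₗ A f).isLocFree_quotient (I.2.2 j)⟩
  map_id R := by
    refine ConcreteCategory.hom_ext _ _ fun I => ?_
    exact Subtype.ext (funext fun j => map_scalarExt_id A (I.1 j))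
  map_comp f g := by
    refine ConcreteCategory.hom_ext _ _ fun I => ?_
    exact Subtype.ext (funext fun j => map_scalarExt_comp A f g (I.1 j))

/-- The Severi–Brauer variety `SB(A) = Flag(1; A)`. -/
def severiBrauer (n : ℕ) : CommAlgCat.{u} k ⥤ Type u :=
  flag A n (fun _ : Fin 1 => 1)

/-- The projection `Flag(1, i₂, …, i_r; A) ⟶ SB(A)`, `(I₁, …, I_r) ↦ I₁`. -/
def flagProj (n : ℕ) {s : ℕ} (i : Fin (s + 1) → ℕ) (h : i 0 = 1) :
    flag (k := k) A n i ⟶ severiBrauer A n where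
  app R := ↾fun I => ⟨fun _ => I.1 0, fun _ _ _ => le_rfl, fun _ => by
    have := I.2.2 0
    rwa [h] at this⟩
  naturality _ _ _ := rfl

/-- The right annihilator `I° = {a | I a = 0}` of a left ideal. -/
def rightAnn (R : Type u) [CommRing R] {B : Type u} [Ring B] [Algebra R B] (I : Ideal B) :
    Submodule R B where
  carrier := {a | ∀ x ∈ I, x * a = 0}
  zero_mem' := fun x _ => mul_zero x
  add_mem' := fun {a b} ha hb x hx => by rw [mul_add, ha x hx, hb x hx, add_zero]
  smul_mem' := fun c a ha x hx => by rw [mul_smul_comm, ha x hx, smul_zero]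

/-- The product `J° I`, as a submodule over the scalars. -/
def annMul (R : Type u) [CommRing R] {B : Type u} [Ring B] [Algebra R B] (J I : Ideal B) :
    Submodule R B :=
  rightAnn R J * I.restrictScalars R

/-- The tautological left ideal `𝓘`: its value at the point `I ∈ SB(A)(R)` is `I`. -/
def tautIdeal (n : ℕ) (p : (severiBrauer (k := k) A n).Elements) : Ideal (p.1 ⊗[k] A) :=
  p.2.1 0

theorem scalarExt_mem_annMul {R R' : CommAlgCat.{u} k} (f : R ⟶ R') (I : Ideal (R ⊗[k] A))
    {x : R ⊗[k] A} (hx : x ∈ annMul R I I) :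
    scalarExt A f x ∈ annMul R' (I.map (scalarExt A f)) (I.map (scalarExt A f)) := by
  refine Submodule.mul_induction_on hx ?_ ?_
  · intro a ha b hb
    rw [map_mul]
    refine Submodule.mul_mem_mul ?_ (Ideal.mem_map_of_mem (scalarExt A f) hb)
    intro y hy
    refine Submodule.span_induction (p := fun y _ => y * scalarExt A f a = 0) ?_ ?_ ?_ ?_ hy
    · rintro _ ⟨z, hz, rfl⟩
      rw [← map_mul, ha z hz, map_zero]
    · exact zero_mul _
    · intro y z _ _ hy hz
      rw [add_mul, hy, hz, add_zero]
    · intro c y _ hy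
      rw [smul_eq_mul, mul_assoc, hy, mul_zero]
  · intro x y hx hy
    rw [map_add]
    exact Submodule.add_mem _ hx hy

theorem map_tautIdeal (n : ℕ) {p q : (severiBrauer (k := k) A n).Elements} (f : p ⟶ q) :
    (tautIdeal A n p).map (scalarExt A f.val) = tautIdeal A n q :=
  congrFun (congrArg Subtype.val f.property) 0

/-- The family `𝓥 = 𝓘° 𝓘` on `SB(A)`, with value `I° I ⊆ A ⊗ R` at `I ∈ SB(A)(R)`. -/
def tautBundle (n : ℕ) : ModuleFamily (severiBrauer (k := k) A n) where
  obj p := annMul p.1 (tautIdeal A n p) (tautIdeal A n p)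
  res {p q} f :=
    { toFun := fun x => ⟨scalarExt A f.val x.1, by
        have h := scalarExt_mem_annMul A f.val _ x.2
        rwa [map_tautIdeal] at h⟩
      map_add' := fun x y => Subtype.ext (map_add _ _ _)
      map_smul' := fun r x => Subtype.ext ((scalarExtₛₗ A f.val).map_smulₛₗ r x.1) }
  res_id p x := Subtype.ext (DFunLike.congr_fun (scalarExt_id A p.1) x.1)
  res_comp f g x := Subtype.ext (DFunLike.congr_fun (scalarExt_comp A f.val g.val) x.1)

/-- The `j`-th step of a flag in the value `I° I` of `𝓥` at a point of `SB(A)`, as a submodule of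
`A ⊗ R`. -/
def tautStep {n m s : ℕ} {d : Fin s → ℕ} {p : (severiBrauer (k := k) A n).Elements}
    (W : (tautBundle A n).Flags m d p) (j : Fin s) : Submodule p.1 (p.1 ⊗[k] A) :=
  Submodule.map (annMul p.1 (tautIdeal A n p) (tautIdeal A n p)).subtype (W.1 j)

/-- The type `(n - i_r, …, n - i_2)` of the flags that correspond to the type
`(i_1, i_2, …, i_r)`. -/
def coType (n : ℕ) {s : ℕ} (i : Fin (s + 1) → ℕ) : Fin s → ℕ :=
  fun j => n - i j.rev.succ

end

end TwistedFlag

open TwistedFlag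

/-! Write `B = R ⊗ A`. Two facts turn the geometry into algebra with idempotents. First, a left
ideal of `B` with projective quotient is `B e` for an idempotent `e`: an `R`-linear projector onto
it can be averaged with a separability element of `A` into a `B`-linear one
(`exists_idempotent_span_eq`). Second, for `I = B e` and `J = B f` the product `J° I` is the corner
`(1 - f) B e` (`annMul_span`). At a prime of `R` the corner `g B e` has rank `rank g * rank e`,
where ranks of idempotents are matrix ranks over a splitting field (`exists_rank_function`). Hence
`I° I` has rank `n - 1` on `SB(A)`, and all these corners commute with base change.

Let `I = B e` with `e` of rank one. Morita theory identifies `B` with `End_R(B e)`: `e` is full, so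
`B` acts faithfully on `B e` (`eq_of_mul_eq`), and `e B e = R e`, so every linear endomorphism of `B
e` is a left multiplication (`exists_mul_eq`). Faithfulness shows that `J° I` determines `J`, with
order reversed (`le_of_annMul_le`). Conversely, a projector onto a summand `W` of `(1 - e) B e` is
left multiplication by an idempotent `g` with `e g = 0`, and `J = B (1 - g)` is the required ideal
(`exists_annMul_eq`). This makes the map of functors bijective on points.

Representing schemes inherit the result because a `k`-scheme is determined, morphisms included, by
its points in `k`-algebras (`points` is fully faithful). -/

namespace TwistedFlag

/-! ### The functor of points on affine schemes is fully faithful -/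

noncomputable section Points

variable {k : Type u} [Field k] {X Y : Over (Spec (CommRingCat.of k))}

/-- The morphism of schemes underlying a point with values in a `k`-algebra. -/
def ptLeft {R : CommAlgCat.{u} k} (x : ((points k).obj X).obj R) :
    Spec (CommRingCat.of R) ⟶ X.left :=
  CommaMorphism.left x

theorem ptLeft_injective {R : CommAlgCat.{u} k} {x y : ((points k).obj X).obj R}
    (h : ptLeft x = ptLeft y) : x = y :=
  Over.OverMorphism.ext h

theorem ptLeft_comp_hom {R : CommAlgCat.{u} k} (x : ((points k).obj X).obj R) :
    ptLeft x ≫ X.hom = Spec.map (CommRingCat.ofHom (algebraMap k R)) :=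
  CommaMorphism.w x

theorem ptLeft_map {R R' : CommAlgCat.{u} k} (f : R ⟶ R') (x : ((points k).obj X).obj R) :
    ptLeft (((points k).obj X).map f x) =
      Spec.map (CommRingCat.ofHom (f.hom : R →+* R')) ≫ ptLeft x :=
  rfl

/-- A morphism `Spec R ⟶ X` makes `R` into a `k`-algebra. -/
def chartAlg {R : CommRingCat.{u}} (h : Spec R ⟶ X.left) : CommAlgCat.{u} k :=
  letI : Algebra k R := (Spec.preimage (h ≫ X.hom)).hom.toAlgebra
  CommAlgCat.of k R

/-- A morphism `Spec R ⟶ X` as a point of `X` over `k`. -/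
def chartPoint {R : CommRingCat.{u}} (h : Spec R ⟶ X.left) :
    ((points k).obj X).obj (chartAlg h) :=
  Over.homMk (U := (algSpec (CommRingCat.of k)).obj (Opposite.op (chartAlg h))) h
    (Spec.map_preimage (h ≫ X.hom)).symm

/-- Morphisms of functors of points commute with arbitrary morphisms of the sources. -/
theorem ptLeft_app_eq (η : (points k).obj X ⟶ (points k).obj Y) {R R' : CommAlgCat.{u} k}
    (x : ((points k).obj X).obj R) (x' : ((points k).obj X).obj R')
    (g : Spec (CommRingCat.of R') ⟶ Spec (CommRingCat.of R)) (h : g ≫ ptLeft x = ptLeft x') :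
    ptLeft (η.app R' x') = g ≫ ptLeft (η.app R x) := by
  -- `g` is not assumed to lie over `k`: both structure maps factor through `X`, which forces the
  -- ring map `φ` to be `k`-linear, and then naturality of `η` applies.
  obtain ⟨φ, rfl⟩ := Spec.map_surjective g
  have hφ : CommRingCat.ofHom (algebraMap k R) ≫ φ = CommRingCat.ofHom (algebraMap k R') := by
    apply Spec.map_injective
    rw [Spec.map_comp, ← ptLeft_comp_hom x, ← ptLeft_comp_hom x', ← h, Category.assoc]
  let f : R ⟶ R' := CommAlgCat.ofHom (R := k) (X := R) (Y := R')
    { φ.hom with commutes' := fun c => congrArg (fun ψ => ψ.hom c) hφ }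
  have hx : ((points k).obj X).map f x = x' := ptLeft_injective h
  have := congrArg ptLeft (NatTrans.naturality_apply η f x)
  rw [hx] at this
  exact this.trans (ptLeft_map f (η.app R x))

/-- The value of a morphism of functors of points on a morphism `Spec R ⟶ X`. -/
def chartMap (η : (points k).obj X ⟶ (points k).obj Y) {R : CommRingCat.{u}}
    (h : Spec R ⟶ X.left) : Spec R ⟶ Y.left :=
  ptLeft (η.app (chartAlg h) (chartPoint h))

theorem chartMap_comp_hom (η : (points k).obj X ⟶ (points k).obj Y) {R : CommRingCat.{u}}
    (h : Spec R ⟶ X.left) : chartMap η h ≫ Y.hom = h ≫ X.hom :=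
  (ptLeft_comp_hom (η.app (chartAlg h) (chartPoint h))).trans
    (ptLeft_comp_hom (chartPoint h)).symm

theorem ptLeft_app_eq_comp_chartMap (η : (points k).obj X ⟶ (points k).obj Y)
    {R : CommRingCat.{u}} (h : Spec R ⟶ X.left) {R' : CommAlgCat.{u} k}
    (x : ((points k).obj X).obj R') (g : Spec (CommRingCat.of R') ⟶ Spec R)
    (hg : g ≫ h = ptLeft x) : ptLeft (η.app R' x) = g ≫ chartMap η h :=
  ptLeft_app_eq η (chartPoint h) x g hg

/-- This is the compatibility that `exists_hom_of_affine` needs. Charts take their `k`-structure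
from `X`, so `g` may be any morphism of schemes. -/
theorem chartMap_comp (η : (points k).obj X ⟶ (points k).obj Y) {R R' : CommRingCat.{u}}
    (g : Spec R' ⟶ Spec R) (h : Spec R ⟶ X.left) : chartMap η (g ≫ h) = g ≫ chartMap η h :=
  ptLeft_app_eq_comp_chartMap η h (chartPoint (g ≫ h)) g rfl

theorem ptLeft_app_eq_chartMap (η : (points k).obj X ⟶ (points k).obj Y) {R : CommAlgCat.{u} k}
    (x : ((points k).obj X).obj R) : ptLeft (η.app R x) = chartMap η (ptLeft x) := by
  rw [ptLeft_app_eq_comp_chartMap η (ptLeft x) x (𝟙 _) (Category.id_comp _), Category.id_comp]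

/-- Morphisms out of a scheme agree if they agree on all affine schemes mapping to it. -/
theorem hom_ext_of_affine {Z W : Scheme.{u}} {f g : Z ⟶ W}
    (h : ∀ (R : CommRingCat.{u}) (p : Spec R ⟶ Z), p ≫ f = p ≫ g) : f = g :=
  Scheme.Cover.hom_ext Z.affineCover _ _ fun a => h _ (Z.affineCover.f a)

theorem points_map_injective {f g : X ⟶ Y} (h : (points k).map f = (points k).map g) : f = g := by
  refine Over.OverMorphism.ext (hom_ext_of_affine fun R p => ?_)
  have := congrArg (fun η => chartMap η p) h
  exact this

/-- A compatible family of maps on affine points comes from a morphism of schemes. -/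
theorem exists_hom_of_affine {Z W : Scheme.{u}}
    (m : ∀ {R : CommRingCat.{u}}, (Spec R ⟶ Z) → (Spec R ⟶ W))
    (hm : ∀ {R R' : CommRingCat.{u}} (g : Spec R' ⟶ Spec R) (p : Spec R ⟶ Z),
      m (g ≫ p) = g ≫ m p) :
    ∃ F : Z ⟶ W, ∀ {R : CommRingCat.{u}} (p : Spec R ⟶ Z), p ≫ F = m p := by
  let 𝒰 := Z.affineOpenCover
  -- The overlaps need not be affine, so the equality is tested on affine schemes mapping to them.
  have hc (i j) : Limits.pullback.fst (𝒰.f i) (𝒰.f j) ≫ m (𝒰.f i) =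
      Limits.pullback.snd (𝒰.f i) (𝒰.f j) ≫ m (𝒰.f j) := by
    refine hom_ext_of_affine fun R p => ?_
    have h1 := hm (p ≫ Limits.pullback.fst (𝒰.f i) (𝒰.f j)) (𝒰.f i)
    have h2 := hm (p ≫ Limits.pullback.snd (𝒰.f i) (𝒰.f j)) (𝒰.f j)
    simp only [Category.assoc] at h1 h2
    rw [← h1, ← h2, Limits.pullback.condition]
  have hF (i) : 𝒰.f i ≫ 𝒰.openCover.glueMorphisms (fun i => m (𝒰.f i)) hc = m (𝒰.f i) :=
    𝒰.openCover.ι_glueMorphisms _ hc i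
  refine ⟨𝒰.openCover.glueMorphisms (fun i => m (𝒰.f i)) hc, fun p => ?_⟩
  -- A general `p` need not factor through one chart; the comparison is made on the pull-back of the
  -- cover along `p`.
  have key (i : 𝒰.I₀) : Limits.pullback.fst p (𝒰.f i) ≫ p ≫
      𝒰.openCover.glueMorphisms (fun i => m (𝒰.f i)) hc =
      Limits.pullback.fst p (𝒰.f i) ≫ m p := by
    refine hom_ext_of_affine fun S q => ?_
    have h1 := hm (q ≫ Limits.pullback.fst p (𝒰.f i)) p
    have h2 := hm (q ≫ Limits.pullback.snd p (𝒰.f i)) (𝒰.f i)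
    simp only [Category.assoc] at h1 h2
    rw [← h1, Limits.pullback.condition_assoc, hF, ← h2, Limits.pullback.condition]
  exact Scheme.Cover.hom_ext (𝒰.openCover.pullback₁ p) _ _ key

theorem points_map_surjective (η : (points k).obj X ⟶ (points k).obj Y) :
    ∃ f : X ⟶ Y, (points k).map f = η := by
  obtain ⟨F, hF⟩ := exists_hom_of_affine (fun p => chartMap η p) (fun g p => chartMap_comp η g p)
  have hFY : F ≫ Y.hom = X.hom := by
    refine hom_ext_of_affine fun R p => ?_
    rw [← chartMap_comp_hom η p, ← hF, Category.assoc]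
  refine ⟨Over.homMk F hFY, ?_⟩
  ext R x
  exact ptLeft_injective ((hF _).trans (ptLeft_app_eq_chartMap η x).symm)

instance : (points k).Full := ⟨fun η => points_map_surjective η⟩

instance : (points k).Faithful := ⟨fun h => points_map_injective h⟩

end Points

/-! ### Azumaya algebras over a field -/

section Azumaya

variable {k : Type u} [Field k] {A : Type u} [Ring A] [Algebra k A] {n : ℕ}

/-- If `A` becomes a matrix algebra over `K`, it does so over every extension of `K`. -/
theorem nonempty_algEquiv_matrix_of_algHom [Module.Finite k A] {K L : Type u} [Field K] [Field L]
    [Algebra k K] [Algebra k L] (ι : K →ₐ[k] L)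
    (e : K ⊗[k] A ≃ₐ[K] Matrix (Fin n) (Fin n) K) :
    Nonempty (L ⊗[k] A ≃ₐ[L] Matrix (Fin n) (Fin n) L) := by
  let m : Matrix (Fin n) (Fin n) K →ₐ[k] Matrix (Fin n) (Fin n) L := ι.mapMatrix
  let ψ : A →ₐ[k] Matrix (Fin n) (Fin n) L :=
    m.comp ((e.toAlgHom.restrictScalars k).comp Algebra.TensorProduct.includeRight)
  let Φ : L ⊗[k] A →ₐ[L] Matrix (Fin n) (Fin n) L :=
    Algebra.TensorProduct.lift (Algebra.ofId L _) ψ fun l a => Algebra.commutes l (ψ a)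
  have hΦ (t : K ⊗[k] A) : Φ (Algebra.TensorProduct.map ι (AlgHom.id k A) t) = m (e t) := by
    induction t with
    | zero => simp
    | add x y hx hy => simp only [map_add, hx, hy]
    | tmul c a =>
      have h1 : c ⊗ₜ[k] a = c • ((1 : K) ⊗ₜ[k] a) := by simp [TensorProduct.smul_tmul']
      have h2 : m (c • e (1 ⊗ₜ a)) = ι c • m (e (1 ⊗ₜ a)) := by
        ext i j; simp [m]
      rw [h1, map_smul e, h2, ← h1]
      rw [Algebra.TensorProduct.map_tmul, Algebra.smul_def]
      exact Algebra.TensorProduct.lift_tmul ..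
  -- The image of `Φ` contains the matrix units, which already come from `K` and span over `L`.
  -- Equality of dimensions then gives injectivity.
  have hsurj : Function.Surjective Φ := by
    intro M
    have hM : M = ∑ i, ∑ j, M i j • m (Matrix.single i j 1) := by
      conv_lhs => rw [Matrix.matrix_eq_sum_single M]
      refine Finset.sum_congr rfl fun i _ => Finset.sum_congr rfl fun j _ => ?_
      ext a b
      simp [m, Matrix.single_apply]
    refine ⟨∑ i, ∑ j, M i j • Algebra.TensorProduct.map ι (AlgHom.id k A)
      (e.symm (Matrix.single i j 1)), ?_⟩
    rw [map_sum]
    conv_rhs => rw [hM]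
    refine Finset.sum_congr rfl fun i _ => ?_
    rw [map_sum]
    refine Finset.sum_congr rfl fun j _ => ?_
    rw [map_smul, hΦ, AlgEquiv.apply_symm_apply]
  have hdim : Module.finrank L (L ⊗[k] A) = Module.finrank L (Matrix (Fin n) (Fin n) L) := by
    rw [Module.finrank_baseChange, ← Module.finrank_baseChange (R := K),
      e.toLinearEquiv.finrank_eq, Module.finrank_matrix, Module.finrank_matrix]
    simp
  have hinj : Function.Injective Φ :=
    (LinearMap.injective_iff_surjective_of_finrank_eq_finrank hdim (f := Φ.toLinearMap)).2 hsurj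
  exact ⟨AlgEquiv.ofBijective Φ ⟨hinj, hsurj⟩⟩

theorem IsAzumayaOfDegree.finite (hA : IsAzumayaOfDegree k A n) : Module.Finite k A := by
  obtain ⟨-, ⟨e⟩⟩ := hA
  have : Module.Finite (SeparableClosure k) (SeparableClosure k ⊗[k] A) :=
    Module.Finite.equiv e.symm.toLinearEquiv
  exact Module.Finite.of_finite_tensorProduct_of_faithfullyFlat (SeparableClosure k)

/-- Over every algebraically closed extension an Azumaya algebra becomes a matrix algebra. -/
theorem IsAzumayaOfDegree.nonempty_algEquiv (hA : IsAzumayaOfDegree k A n) (L : Type u) [Field L]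
    [IsAlgClosed L] [Algebra k L] : Nonempty (L ⊗[k] A ≃ₐ[L] Matrix (Fin n) (Fin n) L) := by
  have := hA.finite
  obtain ⟨-, ⟨e⟩⟩ := hA
  exact nonempty_algEquiv_matrix_of_algHom (IsAlgClosed.lift : SeparableClosure k →ₐ[k] L) e

/-- Injectivity of `A ⊗ Aᵐᵒᵖ → End A` descends along field extensions. -/
theorem mulLeftRight_injective_of_baseChange (K : Type u) [Field K] [Algebra k K]
    (h : Function.Injective (AlgHom.mulLeftRight K (K ⊗[k] A))) :
    Function.Injective (AlgHom.mulLeftRight k A) := by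
  let b := Module.Free.chooseBasis k A
  let b2 := b.tensorProduct (b.map (MulOpposite.opLinearEquiv k))
  let B := Algebra.TensorProduct.basis K b
  let B2 := B.tensorProduct (B.map (MulOpposite.opLinearEquiv K))
  rw [injective_iff_map_eq_zero]
  intro t ht
  -- `T` is the image of `t` over `K`, defined through coordinates. It acts by zero on the elements
  -- `1 ⊗ x`, hence vanishes, and so do the coordinates of `t`.
  let T := Finsupp.linearCombination K B2 ((b2.repr t).mapRange (algebraMap k K) (map_zero _))
  have key : ∀ x, AlgHom.mulLeftRight K (K ⊗[k] A) T (1 ⊗ₜ x) =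
      1 ⊗ₜ AlgHom.mulLeftRight k A t x := by
    intro x
    have h2 : t = Finsupp.linearCombination k b2 (b2.repr t) := (b2.linearCombination_repr t).symm
    conv_rhs => rw [h2]
    simp only [T, Finsupp.linearCombination_apply]
    rw [Finsupp.sum_mapRange_index (h := fun i a => a • B2 i) (fun _ => zero_smul K _)]
    simp only [Finsupp.sum, map_sum, LinearMap.sum_apply, TensorProduct.tmul_sum]
    refine Finset.sum_congr rfl fun i _ => ?_
    have h3 : AlgHom.mulLeftRight K (K ⊗[k] A) (B2 i) (1 ⊗ₜ x) =
        1 ⊗ₜ AlgHom.mulLeftRight k A (b2 i) x := by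
      simp [B2, b2, B, Module.Basis.tensorProduct_apply']
    rw [map_smul, map_smul, LinearMap.smul_apply, LinearMap.smul_apply, TensorProduct.tmul_smul, h3,
      algebraMap_smul]
  have hT : T = 0 := by
    refine (injective_iff_map_eq_zero _).1 h T (B.ext fun i => ?_)
    rw [Algebra.TensorProduct.basis_apply, key, ht]
    simp
  have h0 := B2.linearIndependent.finsuppLinearCombination_injective (hT.trans (map_zero _).symm)
  refine b2.repr.map_eq_zero_iff.1 (Finsupp.ext fun i => ?_)
  have := DFunLike.congr_fun h0 i
  simpa using this

theorem IsAzumayaOfDegree.nontrivial (hA : IsAzumayaOfDegree k A n) : Nontrivial A := by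
  obtain ⟨hn, ⟨e⟩⟩ := hA
  have : Nonempty (Fin n) := ⟨⟨0, hn⟩⟩
  by_contra hA
  rw [not_nontrivial_iff_subsingleton] at hA
  have : Subsingleton (SeparableClosure k ⊗[k] A) := inferInstance
  exact not_subsingleton _ e.symm.toEquiv.subsingleton

theorem mulLeftRight_injective_of_algEquiv_matrix {K C : Type u} [Field K] [Ring C] [Algebra K C]
    [NeZero n] (e : C ≃ₐ[K] Matrix (Fin n) (Fin n) K) :
    Function.Injective (AlgHom.mulLeftRight K C) :=
  have : IsAzumaya K (Matrix (Fin n) (Fin n) K) := IsAzumaya.matrix K (Fin n)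
  (IsAzumaya.of_AlgEquiv K _ _ e.symm).bij.1

/-- An Azumaya algebra of some degree over a field is an Azumaya algebra. -/
theorem IsAzumayaOfDegree.isAzumaya (hA : IsAzumayaOfDegree k A n) : IsAzumaya k A := by
  have := hA.finite
  have := hA.nontrivial
  obtain ⟨hn, ⟨e⟩⟩ := hA
  have : NeZero n := ⟨by lia⟩
  have hinj := mulLeftRight_injective_of_baseChange (A := A) (SeparableClosure k)
    (mulLeftRight_injective_of_algEquiv_matrix e)
  refine { bij := ⟨hinj, ?_⟩, eq_of_smul_eq_smul := fun h => eq_of_smul_eq_smul h }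
  -- Source and target both have dimension `(dim A)²`.
  refine (LinearMap.injective_iff_surjective_of_finrank_eq_finrank ?_
    (f := (AlgHom.mulLeftRight k A).toLinearMap)).1 hinj
  rw [Module.finrank_tensorProduct, Module.finrank_linearMap,
    (MulOpposite.opLinearEquiv k : A ≃ₗ[k] Aᵐᵒᵖ).finrank_eq]

/-- A linear functional on an Azumaya algebra is a combination of two-sided multiplications. -/
theorem exists_mulLeftRight_eq_functional [IsAzumaya k A] (l : A →ₗ[k] k) :
    ∃ s : A ⊗[k] Aᵐᵒᵖ, ∀ x, AlgHom.mulLeftRight k A s x = l x • 1 := by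
  obtain ⟨s, hs⟩ := (IsAzumaya.AlgHom.mulLeftRight_bij k A).2 (l.smulRight 1)
  exact ⟨s, fun x => by rw [hs]; rfl⟩

/-- A separability element of an Azumaya algebra over a field. -/
theorem exists_separability [IsAzumaya k A] [Nontrivial A] :
    ∃ s : A ⊗[k] Aᵐᵒᵖ, (∀ a : A, (a ⊗ₜ 1) * s = (1 ⊗ₜ MulOpposite.op a) * s) ∧
      AlgHom.mulLeftRight k A s 1 = 1 := by
  -- Take `s` acting as `x ↦ l x • 1` with `l 1 = 1`. Its values are central, so multiplying them by
  -- `a` on either side gives the same endomorphism, and `mulLeftRight` is injective.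
  obtain ⟨l, hl⟩ := Module.Projective.exists_dual_eq_one k (one_ne_zero (α := A))
  obtain ⟨s, hs⟩ := exists_mulLeftRight_eq_functional l
  refine ⟨s, fun a => (IsAzumaya.AlgHom.mulLeftRight_bij k A).1 ?_, by rw [hs, hl, one_smul]⟩
  ext x
  rw [map_mul, map_mul, Module.End.mul_apply, Module.End.mul_apply, hs]
  simp [AlgHom.mulLeftRight_apply]

end Azumaya

/-! ### Direct summands: local freeness, ranks and base change -/

section Summands

variable {R : Type u} [CommRing R] {M : Type u} [AddCommGroup M] [Module R M]

/-- A section `s` of the quotient map `q` gives the projector `id - s ∘ q`. Summands are handled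
through such projectors below, since these carry projectivity, ranks and base change. -/
theorem exists_isProj_of_projective_quotient (W : Submodule R M) [Module.Projective R (M ⧸ W)] :
    ∃ π : M →ₗ[R] M, LinearMap.IsProj W π := by
  obtain ⟨s, hs⟩ := Module.projective_lifting_property W.mkQ LinearMap.id W.mkQ_surjective
  refine ⟨LinearMap.id - s.comp W.mkQ, fun x => ?_, fun x hx => ?_⟩
  · have h := LinearMap.congr_fun hs (W.mkQ x)
    rw [← Submodule.Quotient.mk_eq_zero]
    simpa [sub_eq_zero] using h.symm
  · simp [(Submodule.Quotient.mk_eq_zero W).2 hx]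

theorem projective_of_isProj {W : Submodule R M} {π : M →ₗ[R] M} (h : LinearMap.IsProj W π)
    [Module.Projective R M] : Module.Projective R W :=
  Module.Projective.of_split W.subtype h.codRestrict (LinearMap.ext h.codRestrict_apply_cod)

theorem finite_of_isProj {W : Submodule R M} {π : M →ₗ[R] M} (h : LinearMap.IsProj W π)
    [Module.Finite R M] : Module.Finite R W :=
  Module.Finite.of_surjective h.codRestrict fun x => ⟨x, h.codRestrict_apply_cod x⟩

theorem projective_quotient_of_isProj {W : Submodule R M} {π : M →ₗ[R] M}
    (h : LinearMap.IsProj W π) [Module.Projective R M] : Module.Projective R (M ⧸ W) := by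
  refine Module.Projective.of_split (W.liftQ (LinearMap.id - π) fun x hx => ?_) W.mkQ ?_
  · simp [h.map_id x hx]
  · ext x
    simpa using h.map_mem x

/-- The rank of a module is the rank of a submodule plus the rank of the quotient, if the latter
is projective. -/
theorem rankAtStalk_add_quotient [Module.Finite R M] [Module.Projective R M] (W : Submodule R M)
    [Module.Projective R (M ⧸ W)] (p : PrimeSpectrum R) :
    Module.rankAtStalk (R := R) W p + Module.rankAtStalk (R := R) (M ⧸ W) p =
      Module.rankAtStalk (R := R) M p := by
  obtain ⟨π, hπ⟩ := exists_isProj_of_projective_quotient W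
  have := projective_of_isProj hπ
  have := finite_of_isProj hπ
  let e : (W × (M ⧸ W)) ≃ₗ[R] M :=
    ((LinearEquiv.refl R W).prodCongr (W.quotientEquivOfIsCompl _ hπ.isCompl)).trans
      (W.prodEquivOfIsCompl _ hπ.isCompl)
  rw [← Module.rankAtStalk_eq_of_equiv e, Module.rankAtStalk_prod, Pi.add_apply]

/-- Compatible projectors on the source and target of a base change induce a base change of their
images. -/
theorem isBaseChange_restrict_of_isProj {R' M' : Type u} [CommRing R'] [Algebra R R']
    [AddCommGroup M'] [Module R M'] [Module R' M'] [IsScalarTower R R' M'] {t : M →ₗ[R] M'}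
    (ht : IsBaseChange R' t) {W : Submodule R M} {W' : Submodule R' M'} {π : M →ₗ[R] M}
    {π' : M' →ₗ[R'] M'} (h : LinearMap.IsProj W π) (h' : LinearMap.IsProj W' π')
    (hc : ∀ x, π' (t x) = t (π x)) (t' : W →ₗ[R] W') (ht' : ∀ x, (t' x : M') = t x) :
    IsBaseChange R' t' := by
  -- The inverse of `R' ⊗ W → W'` is the `R'`-linear extension of `x ↦ 1 ⊗ π x`, restricted to `W'`.
  let g : M →ₗ[R] R' ⊗[R] W := (TensorProduct.mk R R' W 1).comp h.codRestrict
  have hg : W'.subtype.comp ((t'.liftBaseChange R').comp (ht.lift g)) = π' := by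
    refine ht.algHom_ext _ _ fun x => ?_
    change ((t'.liftBaseChange R' (ht.lift g (t x)) : W') : M') = π' (t x)
    rw [ht.lift_eq, hc]
    simp [g, ht']
  let e : R' ⊗[R] W ≃ₗ[R'] W' :=
    LinearEquiv.ofLinearMap (t'.liftBaseChange R') ((ht.lift g).comp W'.subtype)
      (by
        ext x
        exact (LinearMap.congr_fun hg x).trans (h'.map_id x x.2))
      (by
        apply TensorProduct.AlgebraTensorModule.curry_injective
        ext x
        change ht.lift g (t'.liftBaseChange R' (1 ⊗ₜ x) : W') = 1 ⊗ₜ x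
        rw [LinearMap.liftBaseChange_tmul, one_smul, ht', ht.lift_eq]
        simp [g])
  exact IsBaseChange.of_equiv e fun x => by simp [e]

theorem IsBaseChangeAlong.restrict_of_isProj {R' M' : Type u} [CommRing R'] {φ : R →+* R'}
    [AddCommGroup M'] [Module R' M'] {θ : M →ₛₗ[φ] M'} (hθ : IsBaseChangeAlong φ θ)
    {W : Submodule R M} {W' : Submodule R' M'} {π : M →ₗ[R] M} {π' : M' →ₗ[R'] M'}
    (h : LinearMap.IsProj W π) (h' : LinearMap.IsProj W' π') (hc : ∀ x, π' (θ x) = θ (π x))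
    (θ' : W →ₛₗ[φ] W') (hθ' : ∀ x, (θ' x : M') = θ x) : IsBaseChangeAlong φ θ' :=
  letI : Algebra R R' := φ.toAlgebra
  letI : Module R M' := Module.compHom M' φ
  haveI : IsScalarTower R R' M' := ⟨fun r s m => mul_smul (φ r) s m⟩
  letI : Module R W' := Module.compHom W' φ
  haveI : IsScalarTower R R' W' := ⟨fun r s m => mul_smul (φ r) s m⟩
  isBaseChange_restrict_of_isProj (R := R) (R' := R') (t := { θ with map_smul' := θ.map_smulₛₗ})
    hθ h h' hc ({ θ' with map_smul' := θ'.map_smulₛₗ} : W →ₗ[R] W') hθ'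

theorem IsBaseChangeAlong.rankAtStalk_eq {R' M' : Type u} [CommRing R'] {φ : R →+* R'}
    [AddCommGroup M'] [Module R' M'] {θ : M →ₛₗ[φ] M'} (hθ : IsBaseChangeAlong φ θ)
    [Module.Finite R M] [Module.Projective R M] (p : PrimeSpectrum R') :
    Module.rankAtStalk (R := R') M' p = Module.rankAtStalk (R := R) M (p.comap φ) :=
  letI : Algebra R R' := φ.toAlgebra
  letI : Module R M' := Module.compHom M' φ
  haveI : IsScalarTower R R' M' := ⟨fun r s m => mul_smul (φ r) s m⟩
  Module.rankAtStalk_isBaseChange (R := R) (S := R') hθ p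

end Summands

/-! ### Peirce corners -/

section Corner

variable (R : Type u) [CommRing R] {B : Type u} [Ring B] [Algebra R B]

/-- The map `x ↦ g x e`. -/
noncomputable def cornerMap (g e : B) : B →ₗ[R] B :=
  (LinearMap.mulLeft R g).comp (LinearMap.mulRight R e)

theorem cornerMap_apply (g e x : B) : cornerMap R g e x = g * (x * e) := rfl

/-- The submodule `g B e`. -/
noncomputable def corner (g e : B) : Submodule R B := LinearMap.range (cornerMap R g e)

variable {R} {g e : B}

theorem mem_corner (hg : IsIdempotentElem g) (he : IsIdempotentElem e) {x : B} :
    x ∈ corner R g e ↔ g * x = x ∧ x * e = x := by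
  constructor
  · rintro ⟨y, rfl⟩
    rw [cornerMap_apply]
    exact ⟨by rw [← mul_assoc, hg.eq], by rw [mul_assoc, mul_assoc, he.eq]⟩
  · rintro ⟨h1, h2⟩
    exact ⟨x, by rw [cornerMap_apply, h2, h1]⟩

theorem isProj_corner (hg : IsIdempotentElem g) (he : IsIdempotentElem e) :
    LinearMap.IsProj (corner R g e) (cornerMap R g e) :=
  ⟨fun x => ⟨x, rfl⟩, fun x hx => by
    obtain ⟨h1, h2⟩ := (mem_corner hg he).1 hx
    rw [cornerMap_apply, h2, h1]⟩

theorem map_corner_algEquiv {C : Type u} [Ring C] [Algebra R C] (φ : B ≃ₐ[R] C) (g e : B) :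
    (corner R g e).map (φ.toLinearEquiv : B →ₗ[R] C) = corner R (φ g) (φ e) := by
  ext x
  constructor
  · rintro ⟨_, ⟨y, rfl⟩, rfl⟩
    exact ⟨φ y, by simp [cornerMap_apply]⟩
  · rintro ⟨y, rfl⟩
    exact ⟨_, ⟨φ.symm y, rfl⟩, by simp [cornerMap_apply]⟩

/-- In an endomorphism algebra a corner consists of the linear maps between the images. -/
noncomputable def cornerEquiv {V : Type u} [AddCommGroup V] [Module R V] {g e : Module.End R V}
    (hg : IsIdempotentElem g) (he : IsIdempotentElem e) :
    corner R g e ≃ₗ[R] (LinearMap.range e →ₗ[R] LinearMap.range g) where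
  toFun x := (g.rangeRestrict.comp x.1).comp (LinearMap.range e).subtype
  map_add' x y := by ext; simp
  map_smul' r x := by ext; simp
  invFun y := ⟨(LinearMap.range g).subtype.comp (y.comp e.rangeRestrict), by
    refine (mem_corner hg he).2 ⟨?_, ?_⟩
    · ext v
      obtain ⟨w, hw⟩ := (y (e.rangeRestrict v)).2
      simp only [Module.End.mul_apply, LinearMap.comp_apply, Submodule.subtype_apply, ← hw]
      exact LinearMap.congr_fun hg.eq w
    · ext v
      have h : e.rangeRestrict (e v) = e.rangeRestrict v :=
        Subtype.ext (LinearMap.congr_fun he.eq v)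
      simp [Module.End.mul_apply, h]⟩
  left_inv x := by
    obtain ⟨h1, h2⟩ := (mem_corner hg he).1 x.2
    ext v
    have h3 := LinearMap.congr_fun h1 (e v)
    have h4 := LinearMap.congr_fun h2 v
    simp only [Module.End.mul_apply] at h3 h4
    simp [← h4, h3]
  right_inv y := by
    ext ⟨_, v, rfl⟩
    have h : e.rangeRestrict (e v) = e.rangeRestrict v :=
      Subtype.ext (LinearMap.congr_fun he.eq v)
    obtain ⟨w, hw⟩ := (y (e.rangeRestrict v)).2
    have h5 : g (g w) = g w := LinearMap.congr_fun hg.eq w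
    change g ((y (e.rangeRestrict (e v)) : LinearMap.range g) : V) = (y (e.rangeRestrict v) : V)
    rw [h, ← hw, h5]

/-- In a matrix algebra the corner is `Hom(im e, im g)`. -/
theorem finrank_corner_of_algEquiv {L C : Type u} [Field L] [Ring C] [Algebra L C] {n : ℕ}
    (φ : C ≃ₐ[L] Matrix (Fin n) (Fin n) L) {g e : C} (hg : IsIdempotentElem g)
    (he : IsIdempotentElem e) : Module.finrank L (corner L g e) = (φ g).rank * (φ e).rank := by
  let ψ : C ≃ₐ[L] Module.End L (Fin n → L) := φ.trans Matrix.toLinAlgEquiv'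
  rw [← LinearEquiv.finrank_map_eq ψ.toLinearEquiv, map_corner_algEquiv,
    (cornerEquiv (hg.map ψ) (he.map ψ)).finrank_eq, Module.finrank_linearMap, mul_comm]
  rfl

theorem rank_add_rank_one_sub {L : Type u} [Field L] {n : ℕ} {e : Matrix (Fin n) (Fin n) L}
    (he : IsIdempotentElem e) : e.rank + (1 - e).rank = n := by
  let f : Module.End L (Fin n → L) := Matrix.toLinAlgEquiv' e
  have hf : IsIdempotentElem f := he.map Matrix.toLinAlgEquiv'
  have h1 : LinearMap.range (1 - f) = LinearMap.ker f :=
    (LinearMap.IsIdempotentElem.ker_eq_range_one_sub hf).symm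
  have h2 : (1 - e).rank = Module.finrank L (LinearMap.range (1 - f)) := by
    have : 1 - f = Matrix.toLinAlgEquiv' (1 - e) := by simp [f]
    rw [this]
    rfl
  rw [h2, h1]
  exact (LinearMap.finrank_range_add_finrank_ker f).trans (by simp)

end Corner

/-! ### Ranks of corners at the primes of the base -/

section Rank

variable {k : Type u} [Field k] {A : Type u} [Ring A] [Algebra k A] {n : ℕ}

theorem cornerMap_scalarExtₛₗ {R R' : CommAlgCat.{u} k} (f : R ⟶ R') (g e x : R ⊗[k] A) :
    cornerMap R' (scalarExt A f g) (scalarExt A f e) (scalarExtₛₗ A f x) =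
      scalarExtₛₗ A f (cornerMap R g e x) := by
  change _ * (scalarExt A f x * _) = scalarExt A f _
  rw [cornerMap_apply, map_mul, map_mul]

/-- The base change map of a corner. -/
noncomputable def cornerExt {R R' : CommAlgCat.{u} k} (f : R ⟶ R') (g e : R ⊗[k] A) :
    corner R g e →ₛₗ[(f.hom : R →+* R')] corner R' (scalarExt A f g) (scalarExt A f e) where
  toFun x := ⟨scalarExt A f x.1, by
    obtain ⟨_, y, rfl⟩ := x
    exact ⟨_, cornerMap_scalarExtₛₗ f g e y⟩⟩
  map_add' x y := Subtype.ext (map_add _ _ _)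
  map_smul' r x := Subtype.ext ((scalarExtₛₗ A f).map_smulₛₗ r x.1)

theorem isBaseChangeAlong_cornerExt {R R' : CommAlgCat.{u} k} (f : R ⟶ R') {g e : R ⊗[k] A}
    (hg : IsIdempotentElem g) (he : IsIdempotentElem e) :
    IsBaseChangeAlong _ (cornerExt f g e) :=
  (isBaseChangeAlong_scalarExtₛₗ A f).restrict_of_isProj (isProj_corner hg he)
    (isProj_corner (hg.map (scalarExt A f)) (he.map (scalarExt A f)))
    (cornerMap_scalarExtₛₗ f g e) _ fun _ => rfl

/-- The rank of a corner is a product of ranks of idempotents. -/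
theorem exists_rank_function (hA : IsAzumayaOfDegree k A n) (R : CommAlgCat.{u} k)
    (p : PrimeSpectrum R) : ∃ rk : R ⊗[k] A → ℕ, rk 1 = n ∧
      (∀ e, IsIdempotentElem e → rk e + rk (1 - e) = n) ∧
      ∀ g e, IsIdempotentElem g → IsIdempotentElem e →
        Module.rankAtStalk (R := R) (corner R g e) p = rk g * rk e := by
  have := hA.finite
  -- The rank function is the matrix rank over `L`, where `A` splits. The zero ideal of `L` lies
  -- over `p`, so base change to `L` computes ranks at `p`.
  let L := AlgebraicClosure p.asIdeal.ResidueField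
  let f₀ : R →+* L := (algebraMap p.asIdeal.ResidueField L).comp (algebraMap R _)
  let _ : Algebra k L := (f₀.comp (algebraMap k R)).toAlgebra
  let f : R ⟶ CommAlgCat.of k L := CommAlgCat.ofHom { f₀ with commutes' := fun _ => rfl }
  obtain ⟨φ⟩ := hA.nonempty_algEquiv L
  have hp : PrimeSpectrum.comap (f.hom : R →+* L) ⟨⊥, Ideal.isPrime_bot⟩ = p := by
    ext x
    change algebraMap p.asIdeal.ResidueField L (algebraMap R _ x) = 0 ↔ x ∈ p.asIdeal
    rw [map_eq_zero, Ideal.algebraMap_residueField_eq_zero]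
  refine ⟨fun x => (φ (scalarExt A f x)).rank, by simp, fun e he => ?_, fun g e hg he => ?_⟩
  · simp only [map_sub, map_one]
    exact rank_add_rank_one_sub ((he.map (scalarExt A f)).map φ)
  · have hP := projective_of_isProj (isProj_corner (R := R) hg he)
    have hF := finite_of_isProj (isProj_corner (R := R) hg he)
    have h := (isBaseChangeAlong_cornerExt f hg he).rankAtStalk_eq ⟨⊥, Ideal.isPrime_bot⟩
    rw [hp] at h
    refine h.symm.trans ?_
    rw [← finrank_corner_of_algEquiv φ (hg.map (scalarExt A f)) (he.map (scalarExt A f))]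
    exact congrFun Module.rankAtStalk_eq_finrank_of_free _

end Rank

/-! ### Left ideals generated by idempotents -/

section Idempotent

variable {R : Type u} [CommRing R] {B : Type u} [Ring B] [Algebra R B] {e f : B}

theorem mem_span_idempotent (he : IsIdempotentElem e) {x : B} :
    x ∈ Ideal.span {e} ↔ x * e = x := by
  rw [Ideal.mem_span_singleton']
  exact ⟨fun ⟨a, ha⟩ => by rw [← ha, mul_assoc, he.eq], fun h => ⟨x, h⟩⟩

theorem span_le_span_idempotent (hf : IsIdempotentElem f) :
    Ideal.span {e} ≤ Ideal.span {f} ↔ e * f = e := by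
  rw [Ideal.span_singleton_le_iff_mem, mem_span_idempotent hf]

theorem restrictScalars_span_idempotent (he : IsIdempotentElem e) :
    (Ideal.span {e}).restrictScalars R = corner R 1 e := by
  ext x
  rw [Submodule.restrictScalars_mem, mem_span_idempotent he, mem_corner .one he]
  simp

/-- The condition `f * a = 0` means `a = (1 - f) * a`, so the annihilator is `(1 - f) B`. -/
theorem mem_rightAnn_span (hf : IsIdempotentElem f) {a : B} :
    a ∈ rightAnn R (Ideal.span {f}) ↔ f * a = 0 := by
  refine ⟨fun h => h f (Ideal.mem_span_singleton_self f), fun h x hx => ?_⟩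
  rw [← (mem_span_idempotent hf).1 hx, mul_assoc, h, mul_zero]

/-- For left ideals generated by idempotents the product `J° I` is a corner. -/
theorem annMul_span (hf : IsIdempotentElem f) (he : IsIdempotentElem e) :
    annMul R (Ideal.span {f}) (Ideal.span {e}) = corner R (1 - f) e := by
  apply le_antisymm
  · refine Submodule.mul_le.2 fun a ha b hb => (mem_corner hf.one_sub he).2 ⟨?_, ?_⟩
    · rw [mem_rightAnn_span hf] at ha
      rw [sub_mul, one_mul, ← mul_assoc, ha, zero_mul, sub_zero]
    · rw [mul_assoc, (mem_span_idempotent he).1 hb]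
  · rintro _ ⟨x, rfl⟩
    refine Submodule.mul_mem_mul ?_ ?_
    · rw [mem_rightAnn_span hf, mul_sub, mul_one, hf.eq, sub_self]
    · exact (Ideal.span {e}).mul_mem_left x (Ideal.mem_span_singleton_self e)

/-- The quotient by the left ideal generated by an idempotent is a corner. -/
theorem nonempty_quotient_span_equiv (hf : IsIdempotentElem f) :
    Nonempty ((B ⧸ (Ideal.span {f}).restrictScalars R) ≃ₗ[R] corner R 1 (1 - f)) := by
  have h := (isProj_corner (R := R) IsIdempotentElem.one hf).isCompl
  have hk : LinearMap.ker (cornerMap R 1 f) = corner R 1 (1 - f) := by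
    ext x
    rw [LinearMap.mem_ker, cornerMap_apply, mem_corner .one hf.one_sub]
    simp [mul_sub]
  rw [hk] at h
  rw [restrictScalars_span_idempotent hf]
  exact ⟨Submodule.quotientEquivOfIsCompl _ _ h⟩

end Idempotent

/-! ### Idempotent generators of left ideals and their ranks -/

section Azumaya

variable {k : Type u} [Field k] {A : Type u} [Ring A] [Algebra k A] {n : ℕ}

/-- A left ideal with projective quotient is generated by an idempotent. -/
theorem exists_idempotent_span_eq [IsAzumaya k A] [Nontrivial A] {R : Type u} [CommRing R]
    [Algebra k R] (I : Ideal (R ⊗[k] A))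
    [Module.Projective R ((R ⊗[k] A) ⧸ I.restrictScalars R)] :
    ∃ e, IsIdempotentElem e ∧ I = Ideal.span {e} := by
  -- For `s = ∑ a ⊗ c` put `Ψ x s = ∑ a π(c x)`. The separability identity makes this left
  -- `B`-linear in `x`, and `∑ a c = 1` makes it the identity on `I`. It is therefore right
  -- multiplication by `Ψ 1 s`, the required idempotent.
  obtain ⟨π, hπ⟩ := exists_isProj_of_projective_quotient (I.restrictScalars R)
  obtain ⟨s, hs, hs1⟩ := exists_separability (k := k) (A := A)
  let ι : A →ₐ[k] R ⊗[k] A := Algebra.TensorProduct.includeRight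
  let Ψ (x : R ⊗[k] A) : A ⊗[k] Aᵐᵒᵖ →ₗ[k] R ⊗[k] A :=
    TensorProduct.lift (LinearMap.mk₂ k (fun a c => ι a * π (ι c.unop * x))
      (by intros; simp [add_mul]) (by intros; simp)
      (by intros; simp [add_mul, mul_add])
      (by
        intro r a c
        rw [MulOpposite.unop_smul, map_smul, smul_mul_assoc, LinearMap.map_smul_of_tower,
          mul_smul_comm]))
  have hΨ (x a c) : Ψ x (a ⊗ₜ c) = ι a * π (ι c.unop * x) := rfl
  have hΨι (a : A) (x) : Ψ (ι a * x) s = ι a * Ψ x s := by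
    have h1 (t) : Ψ (ι a * x) t = Ψ x ((1 ⊗ₜ MulOpposite.op a) * t) := by
      induction t with
      | zero => simp
      | add t u ht hu => rw [map_add, ht, hu, mul_add, map_add]
      | tmul b c =>
        rw [hΨ, Algebra.TensorProduct.tmul_mul_tmul, hΨ]
        simp [mul_assoc]
    have h2 (t) : Ψ x ((a ⊗ₜ 1) * t) = ι a * Ψ x t := by
      induction t with
      | zero => simp
      | add t u ht hu => rw [mul_add, map_add, ht, hu, map_add, mul_add]
      | tmul b c =>
        rw [hΨ, Algebra.TensorProduct.tmul_mul_tmul, hΨ]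
        simp [mul_assoc]
    rw [h1, ← hs, h2]
  have hΨadd (x y t) : Ψ (x + y) t = Ψ x t + Ψ y t := by
    induction t with
    | zero => simp
    | add t u ht hu => rw [map_add, ht, hu, map_add, map_add]; abel
    | tmul b c => simp only [hΨ, mul_add, map_add]
  have hΨsmul (r : R) (x t) : Ψ (r • x) t = r • Ψ x t := by
    induction t with
    | zero => simp
    | add t u ht hu => rw [map_add, ht, hu, map_add, smul_add]
    | tmul b c => simp only [hΨ, mul_smul_comm, map_smul]
  have hΨmul (b x) : Ψ (b * x) s = b * Ψ x s := by
    induction b with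
    | zero => simpa using hΨsmul 0 0 s
    | add b c hb hc => rw [add_mul, hΨadd, hb, hc, add_mul]
    | tmul r a =>
      have h : r ⊗ₜ[k] a = r • ι a := by simp [ι, TensorProduct.smul_tmul']
      rw [h, smul_mul_assoc, hΨsmul, hΨι, smul_mul_assoc]
  have hmem (x t) : Ψ x t ∈ I := by
    induction t with
    | zero => simp
    | add t u ht hu => rw [map_add]; exact I.add_mem ht hu
    | tmul b c => exact I.mul_mem_left _ (hπ.map_mem _)
  have hid (x) (hx : x ∈ I) : Ψ x s = x := by
    have h1 (t) : Ψ x t = ι (AlgHom.mulLeftRight k A t 1) * x := by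
      induction t with
      | zero => simp
      | add t u ht hu => rw [map_add, ht, hu, map_add, LinearMap.add_apply, map_add, add_mul]
      | tmul b c =>
        rw [hΨ, hπ.map_id _ (I.mul_mem_left _ hx), AlgHom.mulLeftRight_apply, mul_one, map_mul,
          mul_assoc]
    rw [h1, hs1, map_one, one_mul]
  have hxe (x) (hx : x ∈ I) : x * Ψ 1 s = x := by rw [← hΨmul, mul_one, hid x hx]
  exact ⟨Ψ 1 s, hxe _ (hmem _ _), le_antisymm
    (fun x hx => Ideal.mem_span_singleton'.2 ⟨x, hxe x hx⟩)
    ((Ideal.span_singleton_le_iff_mem I).2 (hmem _ _))⟩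

/-- The rank function on idempotents of `R ⊗ A` at a prime of `R`. -/
noncomputable def idemRank (hA : IsAzumayaOfDegree k A n) {R : CommAlgCat.{u} k}
    (p : PrimeSpectrum R) : R ⊗[k] A → ℕ :=
  (exists_rank_function hA R p).choose

section
variable (hA : IsAzumayaOfDegree k A n) {R : CommAlgCat.{u} k} (p : PrimeSpectrum R)

theorem idemRank_one : idemRank hA p 1 = n := (exists_rank_function hA R p).choose_spec.1

theorem idemRank_add {e : R ⊗[k] A} (he : IsIdempotentElem e) :
    idemRank hA p e + idemRank hA p (1 - e) = n :=
  (exists_rank_function hA R p).choose_spec.2.1 e he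

theorem rankAtStalk_corner {g e : R ⊗[k] A} (hg : IsIdempotentElem g) (he : IsIdempotentElem e) :
    Module.rankAtStalk (R := R) (corner R g e) p = idemRank hA p g * idemRank hA p e :=
  (exists_rank_function hA R p).choose_spec.2.2 g e hg he

end

/-- The quotient is `B (1 - f)`, of rank `n (n - rank f)`. Since `i ≤ n` the subtraction is not
truncated, and `1 ≤ n` allows cancelling `n`. -/
theorem isLocFree_quotient_span_iff (hA : IsAzumayaOfDegree k A n) {R : CommAlgCat.{u} k}
    {f : R ⊗[k] A} (hf : IsIdempotentElem f) {i : ℕ} (hi : i ≤ n) :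
    IsLocFree R ((R ⊗[k] A) ⧸ (Ideal.span {f}).restrictScalars R) (n ^ 2 - n * i) ↔
      ∀ p : PrimeSpectrum R, idemRank hA p f = i := by
  have := hA.finite
  obtain ⟨E⟩ := nonempty_quotient_span_equiv (R := R) hf
  have hrk (p : PrimeSpectrum R) : Module.rankAtStalk (R := R)
      ((R ⊗[k] A) ⧸ (Ideal.span {f}).restrictScalars R) p = n * idemRank hA p (1 - f) := by
    rw [Module.rankAtStalk_eq_of_equiv E, rankAtStalk_corner hA p .one hf.one_sub, idemRank_one]
  have hiff (p : PrimeSpectrum R) :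
      n * idemRank hA p (1 - f) = n ^ 2 - n * i ↔ idemRank hA p f = i := by
    have h := idemRank_add hA p hf
    have hn := hA.1
    rw [sq, ← Nat.mul_sub, Nat.mul_right_inj (by lia)]
    lia
  constructor
  · intro h p
    rw [← hiff, ← hrk, h.rank]
  · intro h
    have hP := isProj_corner (R := R) IsIdempotentElem.one hf.one_sub
    have := projective_of_isProj hP
    have := finite_of_isProj hP
    exact ⟨Module.Finite.equiv E.symm, Module.Projective.of_equiv E.symm,
      fun p => by rw [hrk, hiff, h]⟩

/-- A point of a generalized Severi-Brauer variety is generated by an idempotent of the given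
rank. -/
theorem exists_idempotent_of_isLocFree (hA : IsAzumayaOfDegree k A n) {R : CommAlgCat.{u} k}
    {I : Ideal (R ⊗[k] A)} {i : ℕ} (hi : i ≤ n)
    (h : IsLocFree R ((R ⊗[k] A) ⧸ I.restrictScalars R) (n ^ 2 - n * i)) :
    ∃ e, IsIdempotentElem e ∧ I = Ideal.span {e} ∧ ∀ p : PrimeSpectrum R, idemRank hA p e = i := by
  have := hA.isAzumaya
  have := hA.nontrivial
  have := h.projective
  obtain ⟨e, he, rfl⟩ := exists_idempotent_span_eq I
  exact ⟨e, he, rfl, (isLocFree_quotient_span_iff hA he hi).1 h⟩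

end Azumaya

/-! ### Morita theory for idempotents of rank one -/

section Morita

variable {k : Type u} [Field k] {A : Type u} [Ring A] [Algebra k A] {n : ℕ}

/-- The two-sided ideal generated by `x`, as a module over the scalars. -/
def twoSidedSpan (R : Type u) [CommRing R] {B : Type u} [Ring B] [Algebra R B] (x : B) :
    Submodule R B :=
  Submodule.span R (Set.range fun q : B × B => q.1 * x * q.2)

/-- The coordinates of an element lie in the two-sided ideal that it generates. -/
theorem coord_smul_one_mem_twoSidedSpan [IsAzumaya k A] {R : Type u} [CommRing R] [Algebra k R]
    {ι : Type u} (b : Module.Basis ι k A) (x : R ⊗[k] A) (j : ι) :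
    (Algebra.TensorProduct.basis R b).repr x j • (1 : R ⊗[k] A) ∈ twoSidedSpan R x := by
  -- The `j`-th coordinate times `1` is a combination of two-sided multiplications on `A`; these
  -- extend to `R ⊗ A` and keep `x` inside its two-sided ideal.
  obtain ⟨s, hs⟩ := exists_mulLeftRight_eq_functional (b.coord j)
  have h2 : (AlgHom.mulLeftRight k A s).baseChange R x =
      (Algebra.TensorProduct.basis R b).repr x j • (1 : R ⊗[k] A) := by
    induction x with
    | zero => simp
    | add x y hx hy => simp only [map_add, hx, hy, Finsupp.add_apply, add_smul]
    | tmul r y =>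
      rw [LinearMap.baseChange_tmul, hs, ← TensorProduct.smul_tmul]
      simp [Algebra.TensorProduct.basis_repr_tmul, Algebra.TensorProduct.one_def,
        Algebra.smul_def, mul_comm]
  have h1 (t) : (AlgHom.mulLeftRight k A t).baseChange R x ∈ twoSidedSpan R x := by
    induction t with
    | zero => simp
    | add t u ht hu =>
      rw [map_add, LinearMap.baseChange_add]
      exact Submodule.add_mem _ ht hu
    | tmul a c =>
      refine Submodule.subset_span ⟨(1 ⊗ₜ a, 1 ⊗ₜ c.unop), ?_⟩
      clear h2
      induction x with
      | zero => simp
      | add x y hx hy => simp only [mul_add, add_mul, map_add] at hx hy ⊢; rw [hx, hy]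
      | tmul r y => simp
  rw [← h2]
  exact h1 s

/-- The coordinates of an idempotent of nowhere zero rank generate the unit ideal. -/
theorem span_coord_eq_top (hA : IsAzumayaOfDegree k A n) {R : CommAlgCat.{u} k}
    {e : R ⊗[k] A} (he : IsIdempotentElem e) (h : ∀ p : PrimeSpectrum R, idemRank hA p e ≠ 0)
    {ι : Type u} [Fintype ι] (b : Module.Basis ι k A) :
    Ideal.span (Set.range fun j => (Algebra.TensorProduct.basis R b).repr e j) = ⊤ := by
  have := hA.finite
  -- If all coordinates of `e` lay in a maximal ideal `m`, then `e B e = m e B e`. By Nakayama some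
  -- `r ≡ 1` modulo `m` would kill `e B e`, whose rank at `m` is the nonzero number `(rank e)²`.
  by_contra htop
  obtain ⟨m, hm, hle⟩ := Ideal.exists_le_maximal _ htop
  let p : PrimeSpectrum R := ⟨m, hm.isPrime⟩
  have hP := isProj_corner (R := R) he he
  have := projective_of_isProj hP
  have := finite_of_isProj hP
  have hr := rankAtStalk_corner hA p he he
  have hN : corner R e e ≤ m • corner R e e := by
    intro x hx
    obtain ⟨h1, h2⟩ := (mem_corner he he).1 hx
    have h3 : x = ∑ j, (Algebra.TensorProduct.basis R b).repr e j •
        (e * ((x * Algebra.TensorProduct.basis R b j) * e)) := by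
      conv_lhs => rw [← h1, ← h2, ← congrArg (x * ·) he.eq, ← mul_assoc x e e]
      conv_lhs =>
        enter [2, 1, 2]
        rw [← (Algebra.TensorProduct.basis R b).sum_repr e]
      simp only [Finset.mul_sum, Finset.sum_mul, mul_smul_comm, smul_mul_assoc]
    rw [h3]
    exact Submodule.sum_mem _ fun j _ => Submodule.smul_mem_smul
      (hle (Ideal.subset_span ⟨j, rfl⟩)) ⟨_, rfl⟩
  obtain ⟨r, hr1, hr2⟩ := Submodule.exists_sub_one_mem_and_smul_eq_zero_of_fg_of_le_smul m
    (corner R e e) (Module.Finite.iff_fg.1 this) hN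
  have h0 : Module.rankAtStalk (R := R) (corner R e e) p = 0 := by
    rw [Module.rankAtStalk_eq_zero_iff_notMem_support, Module.notMem_support_iff']
    refine fun x => ⟨r, fun hrm => ?_, Subtype.ext (hr2 x x.2)⟩
    refine hm.ne_top ((Ideal.eq_top_iff_one m).2 ?_)
    have := m.sub_mem hrm hr1
    rwa [sub_sub_cancel] at this
  rw [h0] at hr
  exact mul_ne_zero (h p) (h p) hr.symm

variable (hA : IsAzumayaOfDegree k A n) {R : CommAlgCat.{u} k} {e : R ⊗[k] A}

/-- An idempotent of nowhere zero rank is full, and some linear functional maps it to `1`. -/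
theorem one_mem_twoSidedSpan_and_exists_functional (he : IsIdempotentElem e)
    (h : ∀ p : PrimeSpectrum R, idemRank hA p e ≠ 0) :
    1 ∈ twoSidedSpan R e ∧ ∃ μ : R ⊗[k] A →ₗ[R] R, μ e = 1 := by
  have := hA.finite
  have := hA.isAzumaya
  let b := Module.Free.chooseBasis k A
  let b' := Algebra.TensorProduct.basis R b
  have h1 : (1 : R) ∈ Ideal.span (Set.range fun j => b'.repr e j) := by
    rw [span_coord_eq_top hA he h b]
    trivial
  -- One relation `∑ c j * (e)_j = 1` between the coordinates of `e` gives both the expression of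
  -- `1` and the functional `∑ c j • coord j`.
  obtain ⟨c, hc⟩ := (Submodule.mem_span_range_iff_exists_fun R).1 h1
  simp only [smul_eq_mul] at hc
  constructor
  · have h2 : (1 : R ⊗[k] A) = ∑ j, c j • b'.repr e j • (1 : R ⊗[k] A) := by
      simp only [smul_smul, ← Finset.sum_smul, hc, one_smul]
    rw [h2]
    exact Submodule.sum_mem _ fun j _ =>
      Submodule.smul_mem _ _ (coord_smul_one_mem_twoSidedSpan b e j)
  · exact ⟨∑ j, c j • b'.coord j, by simpa using hc⟩

/-- The corner of an idempotent of rank one consists of scalars. -/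
theorem exists_smul_eq_of_mem_corner (he : IsIdempotentElem e)
    (h : ∀ p : PrimeSpectrum R, idemRank hA p e = 1) :
    ∃ μ : R ⊗[k] A →ₗ[R] R, ∀ x ∈ corner R e e, x = μ x • e := by
  have := hA.finite
  obtain ⟨μ, hμ⟩ := (one_mem_twoSidedSpan_and_exists_functional hA he fun p => by
    rw [h]; exact one_ne_zero).2
  have hP := isProj_corner (R := R) he he
  have := projective_of_isProj hP
  have := finite_of_isProj hP
  have hmem : e ∈ corner R e e := (mem_corner he he).2 ⟨he.eq, he.eq⟩
  -- `μ` maps `e B e` onto `R` because `μ e = 1`, and both modules have rank one.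
  have hbij : Function.Bijective (μ.comp (corner R e e).subtype) := by
    refine Module.bijective_of_surjective_of_rankAtStalk_eq (fun r => ⟨r • ⟨e, hmem⟩, ?_⟩) ?_
    · simp [hμ]
    · intro m hm
      have : Nontrivial R := ⟨0, 1, fun h0 =>
        hm.ne_top ((Ideal.eq_top_iff_one m).2 (h0 ▸ m.zero_mem))⟩
      rw [rankAtStalk_corner hA _ he he, h, Module.rankAtStalk_self]
      rfl
  refine ⟨μ, fun x hx => ?_⟩
  have := @hbij.1 ⟨x, hx⟩ (μ x • ⟨e, hmem⟩) (by simp [hμ])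
  exact congrArg Subtype.val this

/-- If `e` is an idempotent of nowhere zero rank, then `B` acts faithfully on `B e`. -/
theorem eq_of_mul_eq (he : IsIdempotentElem e) (h : ∀ p : PrimeSpectrum R, idemRank hA p e ≠ 0)
    {g g' : R ⊗[k] A} (hg : ∀ x, x * e = x → g * x = g' * x) : g = g' := by
  -- Agreement on `B e` spreads to `B e B`, which contains `1`.
  have h1 (z) (hz : z ∈ twoSidedSpan R e) : g * z = g' * z := by
    induction hz using Submodule.span_induction with
    | mem z hz =>
      obtain ⟨⟨x, y⟩, rfl⟩ := hz
      have := hg (x * e) (by rw [mul_assoc, he.eq])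
      simp only [← mul_assoc] at this ⊢
      rw [this]
    | zero => simp
    | add x y _ _ hx hy => rw [mul_add, mul_add, hx, hy]
    | smul r x _ hx => rw [mul_smul_comm, mul_smul_comm, hx]
  simpa using h1 1 (one_mem_twoSidedSpan_and_exists_functional hA he h).1

/-- Every linear endomorphism of `B e`, for `e` of rank one, is a left multiplication. -/
theorem exists_mul_eq (he : IsIdempotentElem e) (h : ∀ p : PrimeSpectrum R, idemRank hA p e = 1)
    (π : R ⊗[k] A →ₗ[R] R ⊗[k] A) (hπ : ∀ x, π x * e = π x) :
    ∃ g, ∀ x, x * e = x → g * x = π x := by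
  obtain ⟨μ, hμ⟩ := exists_smul_eq_of_mem_corner hA he h
  have h1 (z) (hz : z ∈ twoSidedSpan R e) : ∃ g, ∀ x, x * e = x → g * x = π (z * x) := by
    induction hz using Submodule.span_induction with
    | mem z hz =>
      obtain ⟨⟨y, w⟩, rfl⟩ := hz
      -- For `x` in `B e` the element `e w x` lies in `e B e`, so it is `c • e` for a scalar `c`.
      -- Hence `π (y e w x) = c • π (y e) = π (y e) w x`, using `π (y e) e = π (y e)`.
      refine ⟨π (y * e) * w, fun x hx => ?_⟩
      have h2 := hμ (e * (w * x * e)) ⟨_, rfl⟩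
      have h3 : y * e * w * x = μ (e * (w * x * e)) • (y * e) := by
        rw [← mul_smul_comm, ← h2]
        simp only [mul_assoc, hx]
      have h4 : π (y * e) * w * x = π (y * e) * (e * (w * x * e)) := by
        rw [← mul_assoc, hπ]
        simp only [mul_assoc, hx]
      rw [h3, map_smul, h4, h2, mul_smul_comm, hπ, ← h2]
    | zero => exact ⟨0, by simp⟩
    | add x y _ _ hx hy =>
      obtain ⟨g, hg⟩ := hx
      obtain ⟨g', hg'⟩ := hy
      exact ⟨g + g', fun x hx => by rw [add_mul, add_mul, map_add, hg x hx, hg' x hx]⟩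
    | smul r x _ hx =>
      obtain ⟨g, hg⟩ := hx
      exact ⟨r • g, fun x hx => by rw [smul_mul_assoc, smul_mul_assoc, map_smul, hg x hx]⟩
  simpa using h1 1 (one_mem_twoSidedSpan_and_exists_functional hA he fun p => by
    rw [h]; exact one_ne_zero).1

end Morita

/-! ### Flags of left ideals and flags in `I° I` -/

section FlagsOfIdeals

variable {k : Type u} [Field k] {A : Type u} [Ring A] [Algebra k A] {n : ℕ}

theorem map_span_singleton_scalarExt {R R' : CommAlgCat.{u} k} (f : R ⟶ R') (e : R ⊗[k] A) :
    (Ideal.span {e}).map (scalarExt A f) = Ideal.span {scalarExt A f e} := by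
  rw [Ideal.map_span, Set.image_singleton]

theorem extend_corner {R R' : CommAlgCat.{u} k} (f : R ⟶ R') (g e : R ⊗[k] A) :
    extend (scalarExtₛₗ A f) (corner R g e) = corner R' (scalarExt A f g) (scalarExt A f e) := by
  apply le_antisymm
  · refine Submodule.span_le.2 ?_
    rintro _ ⟨_, ⟨x, rfl⟩, rfl⟩
    exact ⟨_, cornerMap_scalarExtₛₗ f g e x⟩
  · rintro _ ⟨y, rfl⟩
    induction y with
    | zero => rw [map_zero]; exact Submodule.zero_mem _
    | add x y hx hy => rw [map_add]; exact Submodule.add_mem _ hx hy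
    | tmul r a =>
      have h : r ⊗ₜ[k] a = r • scalarExtₛₗ A f (1 ⊗ₜ a) := by
        change _ = r • scalarExt A f (1 ⊗ₜ a)
        simp [scalarExt, TensorProduct.smul_tmul']
      rw [h, map_smul, cornerMap_scalarExtₛₗ]
      exact Submodule.smul_mem _ _ (Submodule.subset_span ⟨_, ⟨_, rfl⟩, rfl⟩)

theorem annMul_anti {R : Type u} [CommRing R] {B : Type u} [Ring B] [Algebra R B] {I J J' : Ideal B}
    (h : J ≤ J') : annMul R J' I ≤ annMul R J I :=
  Submodule.mul_le.2 fun _ ha _ hb => Submodule.mul_mem_mul (fun x hx => ha x (h hx)) hb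

theorem tautIdeal_isLocFree (p : (severiBrauer (k := k) A n).Elements) :
    IsLocFree p.1 ((p.1 ⊗[k] A) ⧸ (tautIdeal A n p).restrictScalars p.1) (n ^ 2 - n * 1) :=
  p.2.2.2 0

variable (hA : IsAzumayaOfDegree k A n)

theorem finite_projective_corner [Module.Finite k A] {R : CommAlgCat.{u} k} {g e : R ⊗[k] A}
    (hg : IsIdempotentElem g) (he : IsIdempotentElem e) :
    Module.Finite R (corner R g e) ∧ Module.Projective R (corner R g e) :=
  ⟨finite_of_isProj (isProj_corner hg he), projective_of_isProj (isProj_corner hg he)⟩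

include hA

/-- The formation of `J° I` commutes with base change. -/
theorem extend_annMul {R R' : CommAlgCat.{u} k} (f : R ⟶ R') {I J : Ideal (R ⊗[k] A)} {i j : ℕ}
    (hi : i ≤ n) (hj : j ≤ n)
    (hI : IsLocFree R ((R ⊗[k] A) ⧸ I.restrictScalars R) (n ^ 2 - n * i))
    (hJ : IsLocFree R ((R ⊗[k] A) ⧸ J.restrictScalars R) (n ^ 2 - n * j)) :
    extend (scalarExtₛₗ A f) (annMul R J I) =
      annMul R' (J.map (scalarExt A f)) (I.map (scalarExt A f)) := by
  obtain ⟨e, he, rfl, -⟩ := exists_idempotent_of_isLocFree hA hi hI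
  obtain ⟨g, hg, rfl, -⟩ := exists_idempotent_of_isLocFree hA hj hJ
  rw [map_span_singleton_scalarExt, map_span_singleton_scalarExt, annMul_span hg he,
    annMul_span (hg.map (scalarExt A f)) (he.map (scalarExt A f)), extend_corner, map_sub, map_one]

/-- The family `I° I` is a vector bundle of rank `n - 1` on the Severi-Brauer variety. -/
theorem tautBundle_isVectorBundle : (tautBundle (k := k) A n).IsVectorBundle (n - 1) where
  locFree p := by
    have := hA.finite
    obtain ⟨e, he, hI, hr⟩ := exists_idempotent_of_isLocFree hA hA.1 (tautIdeal_isLocFree p)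
    obtain ⟨h1, h2⟩ := finite_projective_corner (R := p.1) he.one_sub he
    change IsLocFree p.1 (annMul p.1 (tautIdeal A n p) (tautIdeal A n p)) (n - 1)
    rw [hI, annMul_span he he]
    refine ⟨h1, h2, fun q => ?_⟩
    rw [rankAtStalk_corner hA q he.one_sub he]
    have := idemRank_add hA q he
    rw [hr] at this ⊢
    lia
  baseChange {p q} f := by
    obtain ⟨e, he, hI, -⟩ := exists_idempotent_of_isLocFree hA hA.1 (tautIdeal_isLocFree p)
    have he' := he.map (scalarExt A f.val)
    have hI' : tautIdeal A n q = Ideal.span {scalarExt A f.val e} := by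
      rw [← map_tautIdeal A n f, hI, map_span_singleton_scalarExt]
    refine (isBaseChangeAlong_scalarExtₛₗ A f.val).restrict_of_isProj
      (π := cornerMap p.1 (1 - e) e)
      (π' := cornerMap q.1 (scalarExt A f.val (1 - e)) (scalarExt A f.val e)) ?_ ?_
      (cornerMap_scalarExtₛₗ f.val (1 - e) e) ((tautBundle A n).res f) fun _ => rfl
    · rw [hI, annMul_span he he]
      exact isProj_corner he.one_sub he
    · rw [hI', annMul_span he' he', map_sub, map_one]
      exact isProj_corner he'.one_sub he'

variable {R : CommAlgCat.{u} k} {I : Ideal (R ⊗[k] A)}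
  (hI : IsLocFree R ((R ⊗[k] A) ⧸ I.restrictScalars R) (n ^ 2 - n * 1))
include hI

/-- The submodule `J° I` of `I° I` has a locally free quotient of the expected rank. -/
theorem isLocFree_quotient_annMul {J : Ideal (R ⊗[k] A)} (hIJ : I ≤ J) {i : ℕ} (hi : i ≤ n)
    (hJ : IsLocFree R ((R ⊗[k] A) ⧸ J.restrictScalars R) (n ^ 2 - n * i)) :
    IsLocFree R (annMul R I I ⧸ (annMul R J I).comap (annMul R I I).subtype)
      (n - 1 - (n - i)) := by
  have := hA.finite
  have hle := annMul_anti (R := R) (I := I) hIJ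
  obtain ⟨e, he, rfl, hre⟩ := exists_idempotent_of_isLocFree hA hA.1 hI
  obtain ⟨f, hf, rfl, hrf⟩ := exists_idempotent_of_isLocFree hA hi hJ
  rw [annMul_span he he, annMul_span hf he] at *
  obtain ⟨h1, h2⟩ := finite_projective_corner (R := R) he.one_sub he
  have hef := (span_le_span_idempotent hf).1 hIJ
  let W := (corner R (1 - f) e).comap (corner R (1 - e) e).subtype
  -- Left multiplication by `1 - f` projects `(1 - e) B e` onto `(1 - f) B e`; the latter is
  -- contained in the former because `I ≤ J`.
  let π : corner R (1 - e) e →ₗ[R] corner R (1 - e) e :=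
    (LinearMap.mulLeft R (1 - f)).restrict fun x hx => hle <| by
      obtain ⟨-, h4⟩ := (mem_corner he.one_sub he).1 hx
      exact ⟨x, by rw [cornerMap_apply, h4]; rfl⟩
  have hπ : LinearMap.IsProj W π := by
    refine ⟨fun x => ?_, fun x hx => Subtype.ext ((mem_corner hf.one_sub he).1 hx).1⟩
    obtain ⟨-, h4⟩ := (mem_corner he.one_sub he).1 x.2
    exact ⟨x.1, by rw [cornerMap_apply, h4]; rfl⟩
  have := projective_quotient_of_isProj hπ
  refine ⟨inferInstance, this, fun p => ?_⟩
  have h5 := rankAtStalk_add_quotient W p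
  have h6 := idemRank_add hA p he
  have h7 := idemRank_add hA p hf
  rw [Module.rankAtStalk_eq_of_equiv (Submodule.comapSubtypeEquivOfLe hle),
    rankAtStalk_corner hA p he.one_sub he, rankAtStalk_corner hA p hf.one_sub he, hre] at h5
  rw [hre] at h6
  rw [hrf] at h7
  change Module.rankAtStalk (_ ⧸ W) p = _
  lia

/-- The submodule `J° I` of `I° I` determines `J`. -/
theorem le_of_annMul_le {J J' : Ideal (R ⊗[k] A)} {i i' : ℕ} (hi : i ≤ n) (hi' : i' ≤ n)
    (hJ : IsLocFree R ((R ⊗[k] A) ⧸ J.restrictScalars R) (n ^ 2 - n * i))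
    (hJ' : IsLocFree R ((R ⊗[k] A) ⧸ J'.restrictScalars R) (n ^ 2 - n * i'))
    (h : annMul R J I ≤ annMul R J' I) : J' ≤ J := by
  obtain ⟨e, he, rfl, hre⟩ := exists_idempotent_of_isLocFree hA hA.1 hI
  obtain ⟨f, hf, rfl, -⟩ := exists_idempotent_of_isLocFree hA hi hJ
  obtain ⟨f', hf', rfl, -⟩ := exists_idempotent_of_isLocFree hA hi' hJ'
  rw [annMul_span hf he, annMul_span hf' he] at h
  rw [span_le_span_idempotent hf]
  -- The inclusion of corners gives this identity on `B e`, hence in `B` by faithfulness. It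
  -- rearranges to `f' f = f'`.
  have h1 : (1 - f') * (1 - f) = 1 - f := by
    refine eq_of_mul_eq hA he (fun p => by rw [hre]; exact one_ne_zero) fun x hx => ?_
    have h2 : (1 - f) * x ∈ corner R (1 - f) e := ⟨x, by rw [cornerMap_apply, hx]⟩
    rw [mul_assoc]
    exact ((mem_corner hf'.one_sub he).1 (h h2)).1
  have h3 : (1 - f') * (1 - f) = 1 - f - f' + f' * f := by noncomm_ring
  rw [h3] at h1
  have h4 : f' * f = (1 - f - f' + f' * f) - (1 - f) + f' := by abel
  rw [h4, h1, sub_self, zero_add]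

/-- Every submodule of `I° I` with locally free quotient is of the form `J° I`. -/
theorem exists_annMul_eq {i : ℕ} (h1i : 1 ≤ i) (hi : i ≤ n) (W : Submodule R (annMul R I I))
    (hW : IsLocFree R (annMul R I I ⧸ W) (n - 1 - (n - i))) :
    ∃ J : Ideal (R ⊗[k] A), I ≤ J ∧
      IsLocFree R ((R ⊗[k] A) ⧸ J.restrictScalars R) (n ^ 2 - n * i) ∧
      annMul R J I = W.map (annMul R I I).subtype := by
  have := hA.finite
  obtain ⟨e, he, rfl, hre⟩ := exists_idempotent_of_isLocFree hA hA.1 hI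
  revert W
  rw [annMul_span he he]
  intro W hW
  obtain ⟨h1, h2⟩ := finite_projective_corner (R := R) he.one_sub he
  have := hW.projective
  obtain ⟨ρ, hρ⟩ := exists_isProj_of_projective_quotient W
  let V := corner R (1 - e) e
  have hV : LinearMap.IsProj V (cornerMap R (1 - e) e) := isProj_corner he.one_sub he
  -- The projector onto `W` is extended to `B` through `x ↦ (1 - e) x e`. On `B e` it is left
  -- multiplication by some `g`, which is idempotent because `π` is, and satisfies `e g = 0` because
  -- the values of `π` lie in `(1 - e) B`.
  let π : R ⊗[k] A →ₗ[R] R ⊗[k] A := V.subtype.comp (ρ.comp hV.codRestrict)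
  have hπV (x) : π x ∈ V := (ρ (hV.codRestrict x)).2
  have hπW (x) : π x ∈ W.map V.subtype := ⟨_, hρ.map_mem _, rfl⟩
  have hπid (x) (hx : x ∈ W.map V.subtype) : π x = x := by
    obtain ⟨w, hw, rfl⟩ := hx
    change ((ρ (hV.codRestrict w) : V) : R ⊗[k] A) = w
    rw [hV.codRestrict_apply_cod, hρ.map_id w hw]
  have hVe (x) (hx : x ∈ V) : x * e = x := ((mem_corner he.one_sub he).1 hx).2
  obtain ⟨g, hg⟩ := exists_mul_eq hA he hre π fun x => hVe _ (hπV x)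
  have hre0 (p : PrimeSpectrum R) : idemRank hA p e ≠ 0 := by rw [hre]; exact one_ne_zero
  have hgg : IsIdempotentElem g := by
    refine eq_of_mul_eq hA he hre0 fun x hx => ?_
    rw [mul_assoc, hg x hx, hg _ (hVe _ (hπV x)), hπid _ (hπW x)]
  have heg : e * g = 0 := by
    refine eq_of_mul_eq hA he hre0 fun x hx => ?_
    have h3 := ((mem_corner he.one_sub he).1 (hπV x)).1
    rw [mul_assoc, hg x hx, zero_mul, ← h3, ← mul_assoc, he.mul_one_sub_self, zero_mul]
  have hWg : W.map V.subtype = corner R g e := by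
    ext x
    rw [mem_corner hgg he]
    constructor
    · intro hx
      have hxe : x * e = x := by
        obtain ⟨w, -, rfl⟩ := hx
        exact hVe _ w.2
      exact ⟨by rw [hg x hxe, hπid x hx], hxe⟩
    · rintro ⟨h3, h4⟩
      rw [← h3, hg x h4]
      exact hπW x
  -- With `f = 1 - g` the corner `(1 - f) B e` is `g B e = W`. The quotient by `W` has rank `n - 1 -
  -- (n - i)`, which equals `i - 1` only for `1 ≤ i`; then `g` has rank `n - i` and `1 - g` has rank
  -- `i`.
  refine ⟨Ideal.span {1 - g}, ?_, ?_, ?_⟩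
  · rw [span_le_span_idempotent hgg.one_sub, mul_sub, mul_one, heg, sub_zero]
  · rw [isLocFree_quotient_span_iff hA hgg.one_sub hi]
    intro p
    have h5 := rankAtStalk_add_quotient W p
    have h6 := idemRank_add hA p he
    have h7 := idemRank_add hA p hgg
    rw [hW.rank, rankAtStalk_corner hA p he.one_sub he, hre,
      Module.rankAtStalk_eq_of_equiv (Submodule.equivMapOfInjective V.subtype
        V.subtype_injective W), hWg, rankAtStalk_corner hA p hgg he, hre] at h5
    rw [hre] at h6
    lia
  · rw [annMul_span hgg.one_sub he, sub_sub_cancel]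
    exact hWg.symm

end FlagsOfIdeals

/-! ### The isomorphism of functors of points -/

noncomputable section FlagIso

variable {k : Type u} [Field k] {A : Type u} [Ring A] [Algebra k A] {n : ℕ}

theorem flags_ext {m s : ℕ} {d : Fin s → ℕ} {p : (severiBrauer (k := k) A n).Elements}
    {W W' : (tautBundle A n).Flags m d p} (h : ∀ j, tautStep A W j = tautStep A W' j) : W = W' :=
  Subtype.ext (funext fun j => Submodule.map_injective_of_injective
    (Submodule.subtype_injective _) (h j))

/-- Flags over equal but not syntactically identical base points are compared inside `R ⊗ A`, which
does not depend on the base point. -/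
theorem flagBundle_ext {m s : ℕ} {d : Fin s → ℕ} (hV : (tautBundle (k := k) A n).IsVectorBundle m)
    {R : CommAlgCat.{u} k} {y y' : (hV.flagBundle d).obj R} (h1 : y.1 = y'.1)
    (h2 : ∀ j, tautStep A y.2 j = tautStep A y'.2 j) : y = y' := by
  obtain ⟨x, W⟩ := y
  obtain ⟨x', W'⟩ := y'
  obtain rfl : x = x' := h1
  exact congrArg (Sigma.mk x) (flags_ext h2)

theorem map_subtype_extend {R R' M M' : Type u} [CommRing R] [CommRing R'] {φ : R →+* R'}
    [AddCommGroup M] [Module R M] [AddCommGroup M'] [Module R' M'] (θ : M →ₛₗ[φ] M')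
    {V : Submodule R M} {V' : Submodule R' M'} (θ' : V →ₛₗ[φ] V')
    (h : ∀ x, (θ' x : M') = θ x) (W : Submodule R V) :
    (extend θ' W).map V'.subtype = extend θ (W.map V.subtype) := by
  rw [extend, extend, Submodule.map_span]
  congr 1
  ext x
  constructor
  · rintro ⟨_, ⟨w, hw, rfl⟩, rfl⟩
    exact ⟨w.1, ⟨w, hw, rfl⟩, (h w).symm⟩
  · rintro ⟨_, ⟨w, hw, rfl⟩, rfl⟩
    exact ⟨_, ⟨w, hw, rfl⟩, h w⟩

/-- This moves base change of flags into `R ⊗ A`, where `extend_annMul` yields naturality. -/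
theorem tautStep_map {m s : ℕ} {d : Fin s → ℕ} (hV : (tautBundle (k := k) A n).IsVectorBundle m)
    {p q : (severiBrauer (k := k) A n).Elements} (f : p ⟶ q) (W : (tautBundle A n).Flags m d p)
    (j : Fin s) : tautStep A (ModuleFamily.Flags.map hV f W) j =
      extend (scalarExtₛₗ A f.val) (tautStep A W j) :=
  map_subtype_extend (scalarExtₛₗ A f.val) ((tautBundle A n).res f) (fun _ => rfl) (W.1 j)

/-- The flag of submodules of `I° I` attached to a flag of left ideals containing `I`. -/
def flagsOfIdeals (hA : IsAzumayaOfDegree k A n) (p : (severiBrauer (k := k) A n).Elements) {s : ℕ}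
    (c : Fin s → ℕ) (hc : ∀ j, c j ≤ n) (J : Fin s → Ideal (p.1 ⊗[k] A)) (hJ : Antitone J)
    (hle : ∀ j, tautIdeal A n p ≤ J j)
    (hloc : ∀ j, IsLocFree p.1 ((p.1 ⊗[k] A) ⧸ (J j).restrictScalars p.1) (n ^ 2 - n * c j)) :
    (tautBundle A n).Flags (n - 1) (fun j => n - c j) p :=
  let W (j : Fin s) : Submodule p.1 (annMul p.1 (tautIdeal A n p) (tautIdeal A n p)) :=
    (annMul p.1 (J j) (tautIdeal A n p)).comap (annMul p.1 (tautIdeal A n p) _).subtype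
  have hW : Monotone W := fun _ _ hab => Submodule.comap_mono (annMul_anti (hJ hab))
  ⟨W, hW, fun j =>
    isLocFree_quotient_annMul hA (tautIdeal_isLocFree p) (hle j) (hc j) (hloc j)⟩

theorem tautStep_flagsOfIdeals (hA : IsAzumayaOfDegree k A n)
    (p : (severiBrauer (k := k) A n).Elements) {s : ℕ} (c : Fin s → ℕ) (hc : ∀ j, c j ≤ n)
    (J : Fin s → Ideal (p.1 ⊗[k] A)) (hJ : Antitone J) (hle : ∀ j, tautIdeal A n p ≤ J j)
    (hloc : ∀ j, IsLocFree p.1 ((p.1 ⊗[k] A) ⧸ (J j).restrictScalars p.1) (n ^ 2 - n * c j))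
    (j : Fin s) : tautStep A (flagsOfIdeals hA p c hc J hJ hle hloc) j =
      annMul p.1 (J j) (tautIdeal A n p) :=
  (Submodule.map_comap_subtype _ _).trans (inf_eq_right.2 (annMul_anti (hle j)))

variable (hA : IsAzumayaOfDegree k A n) {s : ℕ} (i : Fin (s + 1) → ℕ)
  (h1 : i 0 = 1) (hn : ∀ j, i j ≤ n)

theorem isLocFree_zero {R : CommAlgCat.{u} k} {i : Fin (s + 1) → ℕ} (h1 : i 0 = 1)
    (I : FlagPoints A n i R) :
    IsLocFree R ((R ⊗[k] A) ⧸ (I.1 0).restrictScalars R) (n ^ 2 - n * 1) := by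
  have := I.2.2 0
  rwa [h1] at this

/-- The point of the Severi-Brauer variety given by the first ideal of a flag. -/
def flagPoint {R : CommAlgCat.{u} k} (I : (flag A n i).obj R) :
    (severiBrauer (k := k) A n).Elements :=
  ⟨R, (flagProj A n i h1).app R I⟩

/-- The flag of submodules of `I₁° I₁` attached to a flag of left ideals. -/
def toFlags {R : CommAlgCat.{u} k} (I : (flag A n i).obj R) :
    (tautBundle A n).Flags (n - 1) (coType n i) (flagPoint i h1 I) :=
  flagsOfIdeals hA (flagPoint i h1 I) (fun j => i j.rev.succ) (fun _ => hn _)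
    (fun j => I.1 j.rev.succ)
    (fun _ _ hab => I.2.1 (Fin.succ_le_succ_iff.2 (Fin.rev_le_rev.2 hab)))
    (fun _ => I.2.1 (Fin.zero_le _)) (fun j => I.2.2 j.rev.succ)

theorem tautStep_toFlags {R : CommAlgCat.{u} k} (I : (flag A n i).obj R) (j : Fin s) :
    tautStep A (toFlags hA i h1 hn I) j = annMul R (I.1 j.rev.succ) (I.1 0) :=
  tautStep_flagsOfIdeals ..

variable (hV : (tautBundle (k := k) A n).IsVectorBundle (n - 1))

/-- The morphism from the twisted flag variety to the flag bundle. -/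
def flagHom : flag A n i ⟶ hV.flagBundle (coType n i) where
  app R := ↾fun I => ⟨(flagProj A n i h1).app R I, toFlags hA i h1 hn I⟩
  naturality R R' f := by
    refine ConcreteCategory.hom_ext _ _ fun I => flagBundle_ext hV ?_ fun j => ?_
    · rfl
    refine (tautStep_toFlags hA i h1 hn _ j).trans ?_
    refine Eq.trans ?_ (tautStep_map hV (p := ⟨R, (flagProj A n i h1).app R I⟩)
      (q := ⟨R', (severiBrauer A n).map f ((flagProj A n i h1).app R I)⟩) ⟨f, rfl⟩ _ j).symm
    exact ((congrArg (extend (scalarExtₛₗ A f)) (tautStep_toFlags hA i h1 hn I j)).trans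
      (extend_annMul hA f hA.1 (hn _) (isLocFree_zero h1 I) (I.2.2 j.rev.succ))).symm

theorem tautStep_flagHom {R : CommAlgCat.{u} k} (I : (flag A n i).obj R) (j : Fin s) :
    tautStep A ((flagHom hA i h1 hn hV).app R I).2 j = annMul R (I.1 j.rev.succ) (I.1 0) :=
  tautStep_toFlags hA i h1 hn I j

/-- The base point recovers `I₁`, and each step recovers its ideal by `le_of_annMul_le` applied in
both directions. -/
theorem flagHom_app_injective (R : CommAlgCat.{u} k) :
    Function.Injective ((flagHom hA i h1 hn hV).app R) := by
  intro I I' h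
  have h0 : I.1 0 = I'.1 0 := congrArg (fun y => y.1.1 0) h
  have hs (j : Fin s) :
      annMul R (I.1 j.rev.succ) (I.1 0) = annMul R (I'.1 j.rev.succ) (I'.1 0) := by
    rw [← tautStep_flagHom hA i h1 hn hV, ← tautStep_flagHom hA i h1 hn hV, h]
  refine Subtype.ext (funext fun j => ?_)
  induction j using Fin.cases with
  | zero => exact h0
  | succ j =>
    have := hs j.rev
    rw [Fin.rev_rev, ← h0] at this
    exact le_antisymm
      (le_of_annMul_le hA (isLocFree_zero h1 I) (hn _) (hn _) (I'.2.2 _) (I.2.2 _) this.ge)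
      (le_of_annMul_le hA (isLocFree_zero h1 I) (hn _) (hn _) (I.2.2 _) (I'.2.2 _) this.le)

theorem flagHom_app_surjective (hi : StrictMono i) (R : CommAlgCat.{u} k) :
    Function.Surjective ((flagHom hA i h1 hn hV).app R) := by
  rintro ⟨x, W⟩
  let p : (severiBrauer (k := k) A n).Elements := ⟨R, x⟩
  have hex (j : Fin s) : ∃ J : Ideal (R ⊗[k] A), tautIdeal A n p ≤ J ∧
      IsLocFree R ((R ⊗[k] A) ⧸ J.restrictScalars R) (n ^ 2 - n * i j.rev.succ) ∧
      annMul R J (tautIdeal A n p) = tautStep A W j :=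
    exists_annMul_eq hA (tautIdeal_isLocFree p) (h1 ▸ hi.monotone (Fin.zero_le _)) (hn _) (W.1 j)
      (W.2.2 j)
  choose J hJ1 hJ2 hJ3 using hex
  -- Larger steps have smaller ideals, so the ideals are listed in reverse order behind `I₁` in
  -- `I₀`.
  have hmono (a b : Fin s) (hab : a ≤ b) : J b ≤ J a := by
    refine le_of_annMul_le hA (tautIdeal_isLocFree p) (hn _) (hn _) (hJ2 a) (hJ2 b) ?_
    rw [hJ3, hJ3]
    exact Submodule.map_mono (W.2.1 hab)
  let I₀ : Fin (s + 1) → Ideal (R ⊗[k] A) := Fin.cons (tautIdeal A n p) fun j => J j.rev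
  have hI₀ : Monotone I₀ := by
    intro a b hab
    induction a using Fin.cases with
    | zero =>
      induction b using Fin.cases with
      | zero => exact le_rfl
      | succ b => exact hJ1 _
    | succ a =>
      induction b using Fin.cases with
      | zero => exact absurd hab (not_le.2 (Fin.succ_pos a))
      | succ b => exact hmono _ _ (Fin.rev_le_rev.2 (Fin.succ_le_succ_iff.1 hab))
  have hloc (j) : IsLocFree R ((R ⊗[k] A) ⧸ (I₀ j).restrictScalars R) (n ^ 2 - n * i j) := by
    induction j using Fin.cases with
    | zero =>
      rw [h1]
      exact tautIdeal_isLocFree p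
    | succ j =>
      have := hJ2 j.rev
      rw [Fin.rev_rev] at this
      exact this
  let I : (flag A n i).obj R := ⟨I₀, hI₀, hloc⟩
  refine ⟨I, flagBundle_ext hV (Subtype.ext (funext fun j => ?_)) fun j => ?_⟩
  · rw [Subsingleton.elim j 0]
    rfl
  · refine (tautStep_flagHom hA i h1 hn hV I j).trans (Eq.trans ?_ (hJ3 j))
    change annMul R (J j.rev.rev) (tautIdeal A n p) = _
    rw [Fin.rev_rev]

/-- The isomorphism from the twisted flag variety to the flag bundle. -/
def flagIso (hi : StrictMono i) : flag A n i ≅ hV.flagBundle (coType n i) :=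
  have (R : CommAlgCat.{u} k) : IsIso ((flagHom hA i h1 hn hV).app R) :=
    (isIso_iff_bijective _).2
      ⟨flagHom_app_injective hA i h1 hn hV R, flagHom_app_surjective hA i h1 hn hV hi R⟩
  have := NatIso.isIso_of_isIso_app (flagHom hA i h1 hn hV)
  asIso (flagHom hA i h1 hn hV)

end FlagIso

/-! ### Flag bundles of pull-backs -/

noncomputable section Pullback

variable {k : Type u} [Field k] {A : Type u} [Ring A] [Algebra k A] {n m s : ℕ}
  (hV : (tautBundle (k := k) A n).IsVectorBundle m) (d : Fin s → ℕ)
  {F : CommAlgCat.{u} k ⥤ Type u}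

/-- The morphism from the flag bundle of a pull-back to the flag bundle. -/
def pullbackFlagHom (g : F ⟶ severiBrauer A n) :
    (hV.pullback g).flagBundle d ⟶ hV.flagBundle d where
  app R := ↾fun y => ⟨g.app R y.1, y.2.ofPullback⟩
  naturality R R' f := by
    refine ConcreteCategory.hom_ext _ _ fun y => flagBundle_ext hV ?_ fun j => ?_
    · exact NatTrans.naturality_apply g f y.1
    · exact (tautStep_map hV (ModuleFamily.mapPointHom g
        (p := ⟨R, y.1⟩) (q := ⟨R', F.map f y.1⟩) ⟨f, rfl⟩) y.2.ofPullback j).trans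
        (tautStep_map hV (p := ⟨R, g.app R y.1⟩)
          (q := ⟨R', (severiBrauer A n).map f (g.app R y.1)⟩) ⟨f, rfl⟩ y.2.ofPullback j).symm

/-- The flags over `x` and over `σ x` are the same by definition, so only the bijectivity of `σ` on
base points matters. -/
theorem pullbackFlagHom_app_bijective (σ : F ≅ severiBrauer A n) (R : CommAlgCat.{u} k) :
    Function.Bijective ((pullbackFlagHom hV d σ.hom).app R) := by
  have hσ : Function.Bijective (σ.hom.app R) := (isIso_iff_bijective _).1 inferInstance
  constructor
  · rintro ⟨x, W⟩ ⟨x', W'⟩ h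
    obtain rfl : x = x' := hσ.1 (congrArg Sigma.fst h)
    exact congrArg (Sigma.mk x) (eq_of_heq (Sigma.mk.inj h).2)
  · rintro ⟨y, W⟩
    obtain ⟨x, rfl⟩ := hσ.2 y
    exact ⟨⟨x, W⟩, rfl⟩

/-- The flag bundle of the pull-back along an isomorphism. -/
def pullbackFlagIso (σ : F ≅ severiBrauer A n) :
    (hV.pullback σ.hom).flagBundle d ≅ hV.flagBundle d :=
  have (R : CommAlgCat.{u} k) : IsIso ((pullbackFlagHom hV d σ.hom).app R) :=
    (isIso_iff_bijective _).2 (pullbackFlagHom_app_bijective hV d σ R)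
  have := NatIso.isIso_of_isIso_app (pullbackFlagHom hV d σ.hom)
  asIso (pullbackFlagHom hV d σ.hom)

theorem pullbackFlagIso_hom_comp_proj (σ : F ≅ severiBrauer A n) :
    (pullbackFlagIso hV d σ).hom ≫ hV.flagBundleProj d =
      (hV.pullback σ.hom).flagBundleProj d ≫ σ.hom :=
  rfl

end Pullback

end TwistedFlag

/-! ### The main theorem, for functors of points and for representing schemes -/

theorem mainTheorem1 {k : Type u} [Field k] {A : Type u} [Ring A] [Algebra k A] {n : ℕ}
    (hA : IsAzumayaOfDegree k A n) {s : ℕ} (i : Fin (s + 1) → ℕ) (hi : StrictMono i)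
    (h1 : i 0 = 1) (hn : ∀ j, i j ≤ n) :
    -- the family `𝓥 = 𝓘° 𝓘` is a vector bundle of rank `n - 1` on `SB(A)`
    ∃ hV : (tautBundle (k := k) A n).IsVectorBundle (n - 1),
      -- the canonical isomorphism over `SB(A)`, on the level of functors of points
      (∃! e : flag A n i ≅ hV.flagBundle (coType n i),
        e.hom ≫ hV.flagBundleProj (coType n i) = flagProj A n i h1 ∧
        ∀ (R : CommAlgCat.{u} k) (I : (flag A n i).obj R) (j : Fin s),
          tautStep A (e.hom.app R I).2 j = annMul R (I.1 j.rev.succ) (I.1 0)) ∧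
      -- the same for the schemes `S = SB(A)`, `X = Flag(i; A)`, and the flag bundle `D` of
      -- the vector bundle `𝓥` on `S`
      ∀ (S X D : Over (Spec (CommRingCat.of k)))
        (σ : (points k).obj S ≅ severiBrauer A n)
        (ξ : (points k).obj X ≅ flag A n i)
        (δ : (points k).obj D ≅ (hV.pullback σ.hom).flagBundle (coType n i)),
        ∃ (πX : X ⟶ S) (πD : D ⟶ S),
          (points k).map πX = ξ.hom ≫ flagProj A n i h1 ≫ σ.inv ∧
          (points k).map πD = δ.hom ≫ (hV.pullback σ.hom).flagBundleProj (coType n i) ∧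
          ∃! φ : X ≅ D, φ.hom ≫ πD = πX ∧
            ∀ (R : CommAlgCat.{u} k) (x : ((points k).obj X).obj R) (j : Fin s),
              tautStep A (δ.hom.app R (((points k).map φ.hom).app R x)).2.ofPullback j =
                annMul R ((ξ.hom.app R x).1 j.rev.succ) ((ξ.hom.app R x).1 0) := by
  have hV := tautBundle_isVectorBundle hA
  let E := flagIso hA i h1 hn hV hi
  have hE : E.hom ≫ hV.flagBundleProj (coType n i) = flagProj A n i h1 := rfl
  have hEs (R : CommAlgCat.{u} k) (I : (flag A n i).obj R) (j : Fin s) :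
      tautStep A (E.hom.app R I).2 j = annMul R (I.1 j.rev.succ) (I.1 0) :=
    tautStep_flagHom hA i h1 hn hV I j
  refine ⟨hV, ⟨E, ⟨hE, hEs⟩, fun e he => ?_⟩, fun S X D σ ξ δ => ?_⟩
  -- Uniqueness: the two conditions prescribe the base point and every step of the image flag.
  · refine Iso.ext (NatTrans.ext (funext fun R => ConcreteCategory.hom_ext _ _ fun I => ?_))
    refine flagBundle_ext hV ?_ fun j => (he.2 R I j).trans (hEs R I j).symm
    exact ConcreteCategory.congr_hom (NatTrans.congr_app (he.1.trans hE.symm) R) I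
  · let τ := pullbackFlagIso hV (coType n i) σ
    have hτ : (hV.pullback σ.hom).flagBundleProj (coType n i) =
        τ.hom ≫ hV.flagBundleProj (coType n i) ≫ σ.inv := by
      rw [← Category.assoc, pullbackFlagIso_hom_comp_proj, Category.assoc, Iso.hom_inv_id,
        Category.comp_id]
    obtain ⟨πX, hπX⟩ := (points k).map_surjective (ξ.hom ≫ flagProj A n i h1 ≫ σ.inv)
    obtain ⟨πD, hπD⟩ := (points k).map_surjective
      (δ.hom ≫ (hV.pullback σ.hom).flagBundleProj (coType n i))
    refine ⟨πX, πD, hπX, hπD, ?_⟩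
    -- The isomorphism of functors, transported along the representations, comes from schemes by
    -- full faithfulness.
    let φ : X ≅ D := (points k).preimageIso (ξ ≪≫ E ≪≫ τ.symm ≪≫ δ.symm)
    have hφ : (points k).map φ.hom ≫ δ.hom ≫ τ.hom = ξ.hom ≫ E.hom := by
      simp [φ]
    have hφs (R : CommAlgCat.{u} k) (x : ((points k).obj X).obj R) :
        τ.hom.app R (δ.hom.app R (((points k).map φ.hom).app R x)) = E.hom.app R (ξ.hom.app R x) :=
      ConcreteCategory.congr_hom (NatTrans.congr_app hφ R) x
    have hφπ : φ.hom ≫ πD = πX := by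
      apply (points k).map_injective
      rw [Functor.map_comp, hπD, hπX, hτ, ← hE]
      simp only [← Category.assoc] at hφ ⊢
      rw [hφ]
    have hφt (R : CommAlgCat.{u} k) (x : ((points k).obj X).obj R) (j : Fin s) :
        tautStep A (δ.hom.app R (((points k).map φ.hom).app R x)).2.ofPullback j =
          annMul R ((ξ.hom.app R x).1 j.rev.succ) ((ξ.hom.app R x).1 0) := by
      refine Eq.trans ?_ (hEs R (ξ.hom.app R x) j)
      rw [← hφs]
      rfl
    refine ⟨φ, ⟨hφπ, hφt⟩, fun ψ hψ => Iso.ext ((points k).map_injective ?_)⟩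
    -- After composition with `δ` and `τ` the values are flags over points of `SB(A)`, which are
    -- again determined by base point and steps.
    rw [← cancel_mono δ.hom, ← cancel_mono τ.hom]
    refine NatTrans.ext (funext fun R => ConcreteCategory.hom_ext _ _ fun x => ?_)
    refine flagBundle_ext hV ?_ fun j => (hψ.2 R x j).trans (hφt R x j).symm
    have h := congrArg (points k).map (hψ.1.trans hφπ.symm)
    rw [Functor.map_comp, Functor.map_comp, hπD] at h
    have h' := ConcreteCategory.congr_hom (NatTrans.congr_app h R) x
    exact congrArg (σ.hom.app R) h'
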